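/- Let $R$ be a valuation domain (a commutative domain whose ideals are totally ordered by inclusion). An interval in $\mathrm{Spec}(R)$ is a formal pair $\chi=[\mathfrak p_\chi,\mathfrak q_\chi]$ of primes with $\mathfrak p_\chi\subseteq\mathfrak q_\chi$. A set $\mathcal X$ of intervals is an admissible system if (i) for distinct $\chi,\xi\in\mathcal X$ with $\mathfrak p_\chi\subseteq\mathfrak p_\xi$ one has $\mathfrak q_\chi\subsetneq\mathfrak p_\xi$; (ii) $\mathfrak p_\chi=\mathfrak p_\chi^2$ for all $\chi\in\mathcal X$; (iii) for each non-empty $\mathcal Y\subseteq\mathcal X$ there are $\mu,\nu\in\mathcal X$ with $\mathfrak p_\mu=\bigcup_{\chi\in\mathcal Y}\mathfrak p_\chi$ and $\mathfrak q_\nu=\bigcap_{\chi\in\mathcal Y}\mathfrak q_\chi$. For an ideal $I\neq 0$ put $I^\#=\{r\in R\mid rI\subsetneq I\}$, and put $0^\#=0$. For an interval $\chi$ let $\langle\chi\rangle$ be the set of ideals $I$ with $\mathfrak p_\chi\subseteq I\subseteq I^\#\subseteq\mathfrak q_\chi$. For an admissible system $\mathcal X$ let $$\mathcal C_{\mathcal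 X}=\{M\in\mathrm{Mod}\text{-}R\mid \forall\, 0\neq m\in M\ \exists \chi\in\mathcal X:\ \mathrm{Ann}_R(m)\in\langle\chi\rangle\}.$$ For a module $T$ let $\mathrm{Cogen}(T)$ be the class of modules that embed into a product of copies of $T$. A module $T$ is cosilting if there is an exact sequence $0\to T\to Q_0\xrightarrow{\sigma}Q_1$ with $Q_0,Q_1$ injective such that $\mathrm{Cogen}(T)=\{M\mid \mathrm{Hom}_R(M,\sigma)\text{ is surjective}\}$. A module $T$ is 1-cotilting if it has injective dimension at most one and $\mathrm{Cogen}(T)=\{M\mid\mathrm{Ext}^1_R(M,T)=0\}$. A class of modules is cosilting (respectively 1-cotilting) if it equals $\mathrm{Cogen}(T)$ for some cosilting (respectively 1-cotilting) module $T$. For a cosilting class $\mathcal C$ let $\mathcal K=\{\mathfrak p\in\mathrm{Spec}(R)\mid R/\mathfrak p\in\mathcal C\}$ and, for $\mathfrak p\in\mathcal K$, let $$\varphi(\mathfrak p)=\inf\{\mathfrak q\in\mathcal K\mid R_{\mathfrak q}/\mathfrak p\in\mathcal C\},\qquad \psi(\mathfrak p)=\sup\{\mathfrak q\in\mathcal K\mid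 R_{\varphi(\mathfrak p)}/\mathfrak q\in\mathcal C\},$$ where $R_{\mathfrak q}/\mathfrak p$ is the quotient $R$-module of $R_{\mathfrak q}$ by its $R$-submodule $\mathfrak p$. Let $\mathcal X_{\mathcal C}=\{[\varphi(\mathfrak p),\psi(\mathfrak p)]\mid\mathfrak p\in\mathcal K\}$. Theorem. The cosilting classes in $\mathrm{Mod}\text{-}R$ are precisely the torsion-free classes that are definable, that is, closed under products, pure submodules and direct limits. If $\mathcal X$ is an admissible system, then $\mathcal C_{\mathcal X}$ is a cosilting class; if $\mathcal C$ is a cosilting class, then $\mathcal X_{\mathcal C}$ is an admissible system; and the assignments $\mathcal X\mapsto\mathcal C_{\mathcal X}$ and $\mathcal C\mapsto\mathcal X_{\mathcal C}$ are mutually inverse bijections between the admissible systems of intervals in $\mathrm{Spec}(R)$ and the cosilting classes in $\mathrm{Mod}\text{-}R$. This bijection restricts to a bijection between the admissible systems containing an interval of the form $[0,\mathfrak q]$ with $\mathfrak q\in\mathrm{Spec}(R)$ and the 1-cotilting classes. -/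

import Mathlib

open CategoryTheory

universe u

namespace Cosilting

section Modules

variable {R : Type u} [CommRing R]

/-- `M` is cogenerated by `T`: it embeds into a product of copies of `T`. -/
def cogen (T : ModuleCat.{u} R) : ObjectProperty (ModuleCat.{u} R) := fun M =>
  ∃ (I : Type u) (f : M →ₗ[R] (I → T)), Function.Injective f

/-- The class of all modules `M` for which `Hom(M, σ)` is surjective. -/
def homSurjClass {Q₀ Q₁ : ModuleCat.{u} R} (σ : Q₀ →ₗ[R] Q₁) :
    ObjectProperty (ModuleCat.{u} R) := fun M =>
  Function.Surjective (fun g : M →ₗ[R] Q₀ => σ.comp g)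

/-- `T` is a cosilting module: there is an injective copresentation `0 → T → Q₀ → Q₁` with last
map `σ` such that the modules `M` with `Hom(M, σ)` surjective are exactly those cogenerated
by `T`. -/
def IsCosiltingModule (T : ModuleCat.{u} R) : Prop :=
  ∃ (Q₀ Q₁ : ModuleCat.{u} R) (i : T →ₗ[R] Q₀) (σ : Q₀ →ₗ[R] Q₁),
    Module.Injective R Q₀ ∧ Module.Injective R Q₁ ∧
    Function.Injective i ∧ Function.Exact i σ ∧ homSurjClass σ = cogen T

/-- A class of modules is cosilting if it is the class cogenerated by some cosilting module. -/
def IsCosiltingClass (C : ObjectProperty (ModuleCat.{u} R)) : Prop :=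
  ∃ T : ModuleCat.{u} R, IsCosiltingModule T ∧ C = cogen T

/-- The class of all modules `M` with `Ext¹(M, T) = 0`. -/
def leftExtOrthogonal (T : ModuleCat.{u} R) : ObjectProperty (ModuleCat.{u} R) := fun M =>
  Subsingleton (Abelian.Ext.{u} M T 1)

/-- `T` is a 1-cotilting module: its injective dimension is at most one, and the modules `M` with
`Ext¹(M, T) = 0` are exactly those cogenerated by `T`. -/
def IsOneCotiltingModule (T : ModuleCat.{u} R) : Prop :=
  HasInjectiveDimensionLE T 1 ∧ leftExtOrthogonal T = cogen T

/-- A class of modules is 1-cotilting if it is the class cogenerated by some 1-cotilting module. -/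
def IsOneCotiltingClass (C : ObjectProperty (ModuleCat.{u} R)) : Prop :=
  ∃ T : ModuleCat.{u} R, IsOneCotiltingModule T ∧ C = cogen T

/-- `(𝒯, ℱ)` is a torsion pair: there are no nonzero homomorphisms from modules in `𝒯` to modules
in `ℱ`, and both classes are maximal with respect to this property. -/
def IsTorsionPair (𝒯 ℱ : ObjectProperty (ModuleCat.{u} R)) : Prop :=
  (∀ M, 𝒯 M ↔ ∀ N, ℱ N → ∀ f : M →ₗ[R] N, f = 0) ∧
  (∀ N, ℱ N ↔ ∀ M, 𝒯 M → ∀ f : M →ₗ[R] N, f = 0)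

/-- A torsion-free class: one that is the second member of a torsion pair. -/
def IsTorsionFreeClass (C : ObjectProperty (ModuleCat.{u} R)) : Prop :=
  ∃ 𝒯 : ObjectProperty (ModuleCat.{u} R), IsTorsionPair 𝒯 C

/-- A submodule `N` of `M` is pure if `P ⊗ N → P ⊗ M` is injective for every module `P`. -/
def IsPureSubmodule {M : Type u} [AddCommGroup M] [Module R M] (N : Submodule R M) : Prop :=
  ∀ P : ModuleCat.{u} R, Function.Injective (N.subtype.lTensor P)

/-- A definable class of modules: (isomorphism-closed and) closed under products, pure submodules
and direct limits. -/
structure IsDefinableClass (C : ObjectProperty (ModuleCat.{u} R)) : Prop where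
  products : ∀ I : Type u, C.IsClosedUnderLimitsOfShape (Discrete I)
  pureSubmodules : ∀ (M : ModuleCat.{u} R) (N : Submodule R M),
    C M → IsPureSubmodule N → C (ModuleCat.of R N)
  directLimits : ∀ (J : Type u) [PartialOrder J] [IsDirectedOrder J] [Nonempty J],
    C.IsClosedUnderColimitsOfShape J

end Modules

section Spectrum

/-- A formal interval `[𝔭, 𝔮]` in `Spec R`, where `𝔭 ⊆ 𝔮` are primes. -/
@[ext]
structure SpecInterval (R : Type u) [CommRing R] where
  lower : PrimeSpectrum R
  upper : PrimeSpectrum R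
  lower_le_upper : lower ≤ upper

variable {R : Type u} [CommRing R]

/-- An admissible system of intervals in `Spec R`. -/
structure IsAdmissible (X : Set (SpecInterval R)) : Prop where
  disjoint : ∀ χ ∈ X, ∀ ξ ∈ X, χ ≠ ξ → χ.lower ≤ ξ.lower → χ.upper < ξ.lower
  idempotent : ∀ χ ∈ X, χ.lower.asIdeal = χ.lower.asIdeal ^ 2
  complete : ∀ Y : Set (SpecInterval R), Y ⊆ X → Y.Nonempty →
    (∃ μ ∈ X, (μ.lower.asIdeal : Set R) = ⋃ χ ∈ Y, (χ.lower.asIdeal : Set R)) ∧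
    (∃ ν ∈ X, (ν.upper.asIdeal : Set R) = ⋂ χ ∈ Y, (χ.upper.asIdeal : Set R))

/-- The attached prime `I^# = {r | rI ⊊ I}` of an ideal `I`. The element `0` is put in by hand; it
satisfies `0I ⊊ I` unless `I = 0`, so this only records the convention `0^# = 0`. -/
def attachedPrime (I : Ideal R) : Set R :=
  {r | r = 0 ∨ Ideal.span {r} * I < I}

/-- The set `⟨𝔭, 𝔮⟩` of all ideals `I` with `𝔭 ⊆ I ⊆ I^# ⊆ 𝔮`. -/
def SpecInterval.ideals (χ : SpecInterval R) : Set (Ideal R) :=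
  {I | χ.lower.asIdeal ≤ I ∧ (I : Set R) ⊆ attachedPrime I ∧
    attachedPrime I ⊆ (χ.upper.asIdeal : Set R)}

/-- The class `C_X` of all modules `M` such that the annihilator of each nonzero element of `M`
belongs to `⟨χ⟩` for some `χ` in `X`. -/
def classOfSystem (X : Set (SpecInterval R)) : ObjectProperty (ModuleCat.{u} R) := fun M =>
  ∀ m : M, m ≠ 0 → ∃ χ ∈ X, Ideal.torsionOf R M m ∈ χ.ideals

/-- The `R`-module `R_𝔮 / 𝔭`, the quotient of the localization `R_𝔮` by the image of `𝔭` (and not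
by the ideal of `R_𝔮` that this image generates). -/
noncomputable def locQuot (q p : PrimeSpectrum R) : ModuleCat.{u} R :=
  ModuleCat.of R (Localization.AtPrime q.asIdeal ⧸
    Submodule.map (Algebra.linearMap R (Localization.AtPrime q.asIdeal)) p.asIdeal)

/-- The set `K` of all primes `𝔭` with `R / 𝔭` in `C`. -/
def primeSupport (C : ObjectProperty (ModuleCat.{u} R)) : Set (PrimeSpectrum R) :=
  {p | C (ModuleCat.of R (R ⧸ p.asIdeal))}

/-- The system `X_C` of all intervals `[φ(𝔭), ψ(𝔭)]` with `𝔭 ∈ K`, where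
`φ(𝔭) = inf {𝔮 ∈ K | R_𝔮 / 𝔭 ∈ C}` and `ψ(𝔭) = sup {𝔮 ∈ K | R_{φ(𝔭)} / 𝔮 ∈ C}`. -/
def systemOfClass (C : ObjectProperty (ModuleCat.{u} R)) : Set (SpecInterval R) :=
  {χ | ∃ p ∈ primeSupport C,
    IsGLB {q | q ∈ primeSupport C ∧ C (locQuot q p)} χ.lower ∧
    IsLUB {q | q ∈ primeSupport C ∧ C (locQuot χ.lower q)} χ.upper}

end Spectrum

end Cosilting

/-! Over a valuation domain the classes in question are controlled by annihilators of single
elements. Call a class limit closed if it is closed under submodules, products and extensions, and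
if `M ⧸ ⋃ N j` belongs to it whenever all `M ⧸ N j` do, for well-ordered chains. Definable
torsion-free classes have this property because `M ⧸ ⋃ N j` embeds into a direct limit. For a
cosilting class it embeds into a reduced product, and `exists_lift_vanishing` shows by a counting
argument on a tree that reduced products stay in the class.

For a limit closed class `C`, a module lies in `C` as soon as `R ⧸ Ann m ∈ C` for all its elements
`m` (`IsLimitClosed.mem_iff`). So `C` amounts to the family `𝒥` of ideals `I` with `R ⧸ I ∈ C`,
which is closed under residuals, intersections, unions of chains and extensions. For a prime `p` in
`𝒥`, the elements `s` with `s p ∉ 𝒥`, together with `0`, form an idempotent prime `φ(p) ≤ p`. A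
proper ideal `I` is in `𝒥` exactly when its attached prime `I^#` is in `𝒥` and `φ(I^#) ≤ I`. The map
`φ` is monotone and constant on intervals, and each value of `φ` contributes one interval; these
intervals form the admissible system.

Conversely, for admissible `X` the class `C_X` is cut out by injectivity of `M ⊗ J → M ⊗ S⁻¹R` for
test pairs `(J, S)` attached to the intervals and to the gaps between them
(`IsAdmissible.classOfSystem_iff`). Ideals and localizations are flat, so the character duals of the
maps `J → S⁻¹R` are maps of injective modules. Their product `σ` turns the criterion into
surjectivity of `Hom(M, σ)`, and `ker σ` is the cosilting module.

If some interval starts at `0`, then `σ` is surjective and lifting along `σ` means vanishing of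
`Ext¹`. Conversely a 1-cotilting class contains `R`, and the annihilator `0` of `1` forces such an
interval. -/

namespace Cosilting

/-! ### Saturated ideals and attached primes in a valuation domain. -/

section Ideals

variable {R : Type u} [CommRing R]

/-- The residual ideal `(I : r)`. -/
def residual (I : Ideal R) (r : R) : Ideal R := Submodule.comap (LinearMap.mulRight R r) I

@[simp]
theorem mem_residual {I : Ideal R} {r x : R} : x ∈ residual I r ↔ x * r ∈ I := Iff.rfl

/-- An ideal `I` is saturated with respect to `q` if all elements outside `q` act injectively
on `R ⧸ I`. -/
def IsSat (q : PrimeSpectrum R) (I : Ideal R) : Prop :=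
  ∀ s ∉ q.asIdeal, ∀ z, s * z ∈ I → z ∈ I

theorem IsSat.mono {q q' : PrimeSpectrum R} {I : Ideal R} (h : IsSat q I) (hq : q ≤ q') :
    IsSat q' I := fun s hs => h s fun hs' => hs (hq hs')

theorem IsSat.le {q : PrimeSpectrum R} {I : Ideal R} (h : IsSat q I) (hI : I ≠ ⊤) :
    I ≤ q.asIdeal := by
  intro s hs
  by_contra hsq
  exact hI ((Ideal.eq_top_iff_one _).2 (h s hsq 1 (by simpa using hs)))

theorem isSat_prime {q p : PrimeSpectrum R} (h : p ≤ q) : IsSat q p.asIdeal := fun _ hs _ hz =>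
  (p.2.mem_or_mem hz).resolve_left fun hs' => hs (h hs')

theorem IsSat.span_mul {q : PrimeSpectrum R} {I : Ideal R} (h : IsSat q I) (hI : I ≤ q.asIdeal)
    [IsDomain R] [ValuationRing R] (x : R) : IsSat q (Ideal.span {x} * I) := by
  intro s hs z hz
  obtain ⟨y, hy, e⟩ := Ideal.mem_span_singleton_mul.1 hz
  by_cases hs0 : s = 0
  · exact absurd (hs0 ▸ zero_mem _) hs
  rcases ValuationRing.dvd_total s y with ⟨w, rfl⟩ | ⟨w, rfl⟩
  · exact Ideal.mem_span_singleton_mul.2 ⟨w, h s hs w hy,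
      mul_left_cancel₀ hs0 (by rw [← e]; ring)⟩
  · exact absurd (Ideal.mul_mem_right w _ (hI hy)) hs

theorem IsSat.residual {q : PrimeSpectrum R} {I : Ideal R} (h : IsSat q I) (x : R) :
    IsSat q (Cosilting.residual I x) := fun s hs z hz =>
  mem_residual.2 (h s hs _ (by rw [← mul_assoc]; exact mem_residual.1 hz))

theorem notMem_span_mul_self [IsDomain R] {p : PrimeSpectrum R} {x : R} (hx : x ≠ 0) :
    x ∉ Ideal.span {x} * p.asIdeal := by
  intro h
  obtain ⟨t, ht, e⟩ := Ideal.mem_span_singleton_mul.1 h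
  have : t = 1 := mul_left_cancel₀ hx (by rw [e, mul_one])
  exact p.2.ne_top ((Ideal.eq_top_iff_one _).2 (this ▸ ht))

theorem residual_span_mul [IsDomain R] {s a c : R} (hs : s ≠ 0) (I : Ideal R) (h : a = s * c) :
    residual (Ideal.span {s} * I) a = residual I c := by
  subst h
  ext r
  simp only [mem_residual, Ideal.mem_span_singleton_mul]
  constructor
  · rintro ⟨z, hz, e⟩
    have : z = r * c := mul_left_cancel₀ hs (by rw [e]; ring)
    rwa [← this]
  · intro h
    exact ⟨_, h, by ring⟩

theorem residual_span_mul' [IsDomain R] {s a x : R} (ha : a ≠ 0) (I : Ideal R) (h : s = a * x) :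
    residual (Ideal.span {s} * I) a = Ideal.span {x} * I := by
  subst h
  ext r
  simp only [mem_residual, Ideal.mem_span_singleton_mul]
  constructor
  · rintro ⟨z, hz, e⟩
    exact ⟨z, hz, mul_left_cancel₀ ha (by rw [mul_comm a r, ← e]; ring)⟩
  · rintro ⟨z, hz, e⟩
    exact ⟨z, hz, by rw [← e]; ring⟩

variable [IsDomain R] [ValuationRing R]

theorem mem_attachedPrime {I : Ideal R} (hI : I ≠ ⊤) {r : R} :
    r ∈ attachedPrime I ↔ ∃ z ∉ I, r * z ∈ I := by
  have h1 : (1 : R) ∉ I := fun h => hI ((Ideal.eq_top_iff_one _).2 h)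
  constructor
  · rintro (rfl | h)
    · exact ⟨1, h1, by simp⟩
    · obtain ⟨-, y, hy, hyr⟩ := SetLike.lt_iff_le_and_exists.1 h
      rcases ValuationRing.dvd_total r y with ⟨z, rfl⟩ | ⟨c, rfl⟩
      · exact ⟨z, fun hz => hyr (Ideal.mem_span_singleton_mul.2 ⟨z, hz, rfl⟩), hy⟩
      · exact ⟨1, h1, by simpa using Ideal.mul_mem_right c I hy⟩
  · rintro ⟨z, hz, hrz⟩
    by_cases h0 : r = 0
    · exact Or.inl h0
    refine Or.inr (SetLike.lt_iff_le_and_exists.2 ⟨Ideal.mul_le_right, r * z, hrz, fun h => ?_⟩)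
    obtain ⟨i, hi, e⟩ := Ideal.mem_span_singleton_mul.1 h
    exact hz (mul_left_cancel₀ h0 e ▸ hi)

theorem SpecInterval.mem_ideals {χ : SpecInterval R} {I : Ideal R} :
    I ∈ χ.ideals ↔ I ≠ ⊤ ∧ χ.lower.asIdeal ≤ I ∧ IsSat χ.upper I := by
  constructor
  · rintro ⟨h1, h2, h3⟩
    have hI : I ≠ ⊤ := by
      rintro rfl
      rcases h2 (Set.mem_univ (1 : R)) with h | h
      · exact one_ne_zero h
      · simp at h
    refine ⟨hI, h1, fun s hs z hz => ?_⟩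
    by_contra hzI
    exact hs (h3 ((mem_attachedPrime hI).2 ⟨z, hzI, hz⟩))
  · rintro ⟨hI, h1, h2⟩
    refine ⟨h1, fun r hr => (mem_attachedPrime hI).2
      ⟨1, fun h => hI ((Ideal.eq_top_iff_one _).2 h), by simpa using hr⟩, fun r hr => ?_⟩
    obtain ⟨z, hz, hrz⟩ := (mem_attachedPrime hI).1 hr
    by_contra hrq
    exact hz (h2 r hrq z hrz)

theorem le_total_ideal (I J : Ideal R) : I ≤ J ∨ J ≤ I :=
  (ValuationRing.iff_ideal_total.1 inferInstance).total I J

theorem primes_le_total (p q : PrimeSpectrum R) : p ≤ q ∨ q ≤ p :=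
  le_total_ideal p.asIdeal q.asIdeal

/-- A nonempty family of ideals that is totally ordered by inclusion has its union as supremum. -/
theorem mem_sSup_ideals {S : Set (Ideal R)} (hS : S.Nonempty) {x : R} :
    x ∈ sSup S ↔ ∃ I ∈ S, x ∈ I :=
  Submodule.mem_sSup_of_directed hS fun I hI J hJ =>
    (le_total_ideal I J).elim (fun h => ⟨J, hJ, h, le_rfl⟩)
      fun h => ⟨I, hI, le_rfl, h⟩

/-- Proper saturated ideals between a prime and a saturated ideal. -/
theorem IsSat.le_span_mul {p : PrimeSpectrum R} {J : Ideal R} (h : IsSat p J) {x : R}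
    (hx : x ∉ J) : J ≤ Ideal.span {x} * p.asIdeal := by
  intro z hz
  rcases ValuationRing.dvd_total x z with ⟨t, rfl⟩ | ⟨c, rfl⟩
  · refine Ideal.mem_span_singleton_mul.2 ⟨t, ?_, rfl⟩
    by_contra ht
    exact hx (h t ht x (by rwa [mul_comm]))
  · exact absurd (Ideal.mul_mem_right c J hz) hx

/-- A nonzero `x` never lies in `x p`, so the ideals `x p` with `x ∉ J` exclude every element
outside `J`. Membership of saturated ideals in a family is thereby reduced to multiples of a single
prime. -/
theorem IsSat.eq_sInf {p : PrimeSpectrum R} {J : Ideal R} (h : IsSat p J) :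
    J = sInf {I | ∃ x ∉ J, I = Ideal.span {x} * p.asIdeal} := by
  apply le_antisymm
  · refine le_sInf ?_
    rintro I ⟨x, hx, rfl⟩
    exact h.le_span_mul hx
  · intro x hx
    by_contra hxJ
    exact notMem_span_mul_self (by rintro rfl; exact hxJ (zero_mem J))
      (Submodule.mem_sInf.1 hx _ ⟨x, hxJ, rfl⟩)

theorem span_mul_prime_of_notMem {p : PrimeSpectrum R} {s : R} (hs : s ∉ p.asIdeal) :
    Ideal.span {s} * p.asIdeal = p.asIdeal :=
  le_antisymm Ideal.mul_le_right ((isSat_prime le_rfl).le_span_mul hs)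

end Ideals

/-! ### Ideal families, lower primes and their admissible systems. -/

section Families

variable {R : Type u} [CommRing R]

/-- The closure properties of the set of ideals `I` with `R ⧸ I` in a suitable class of modules. -/
structure IsIdealFamily (𝒥 : Set (Ideal R)) : Prop where
  top_mem : ⊤ ∈ 𝒥
  residual_mem : ∀ {I : Ideal R}, I ∈ 𝒥 → ∀ r, residual I r ∈ 𝒥
  sInf_mem : ∀ {S : Set (Ideal R)}, S ⊆ 𝒥 → sInf S ∈ 𝒥
  sSup_mem : ∀ {S : Set (Ideal R)}, S ⊆ 𝒥 → S.Nonempty → sSup S ∈ 𝒥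
  ext_mem : ∀ {I J : Ideal R}, I ∈ 𝒥 → J ≤ I → (∀ a ∈ I, residual J a ∈ 𝒥) → J ∈ 𝒥

variable [IsDomain R] {𝒥 : Set (Ideal R)}

open Classical in
/-- The smallest prime `q` with `R_q / p` in the class (described by the family `𝒥`). -/
noncomputable def lowerPrime (𝒥 : Set (Ideal R)) (p : PrimeSpectrum R) : PrimeSpectrum R :=
  if h : ∃ q : PrimeSpectrum R, ∀ s, s ∈ q.asIdeal ↔ s = 0 ∨ Ideal.span {s} * p.asIdeal ∉ 𝒥
  then h.choose else p

namespace IsIdealFamily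

theorem span_mul_mem_of_mul (h𝒥 : IsIdealFamily 𝒥) {p : PrimeSpectrum R} {x y : R}
    (h0 : x * y ≠ 0) (h : Ideal.span {x * y} * p.asIdeal ∈ 𝒥) :
    Ideal.span {x} * p.asIdeal ∈ 𝒥 := by
  have hy : y ≠ 0 := right_ne_zero_of_mul h0
  rw [← residual_span_mul' hy p.asIdeal (mul_comm x y)]
  exact h𝒥.residual_mem h y

/-- Extension closure for `x y p ≤ x p`: the residual of `x y p` by an element `x c` of `x p` is the
residual of `y p` by `c`. -/
theorem span_mul_mem_mul (h𝒥 : IsIdealFamily 𝒥) {p : PrimeSpectrum R} {x y : R} (hx0 : x ≠ 0)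
    (hx : Ideal.span {x} * p.asIdeal ∈ 𝒥) (hy : Ideal.span {y} * p.asIdeal ∈ 𝒥) :
    Ideal.span {x * y} * p.asIdeal ∈ 𝒥 := by
  have e : Ideal.span {x * y} * p.asIdeal = Ideal.span {x} * (Ideal.span {y} * p.asIdeal) := by
    rw [← mul_assoc, Ideal.span_singleton_mul_span_singleton]
  rw [e]
  refine h𝒥.ext_mem hx (Ideal.mul_mono_right Ideal.mul_le_right) fun a ha => ?_
  obtain ⟨c, hc, rfl⟩ := Ideal.mem_span_singleton_mul.1 ha
  rw [residual_span_mul hx0 _ rfl]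
  exact h𝒥.residual_mem hy c

variable [ValuationRing R]

/-- Of two elements one divides the other, so closure under multiples already gives closure under
sums. Primality is the contrapositive of `span_mul_mem_mul`. -/
theorem exists_lower (h𝒥 : IsIdealFamily 𝒥) {p : PrimeSpectrum R} (hp : p.asIdeal ∈ 𝒥) :
    ∃ q : PrimeSpectrum R, ∀ s, s ∈ q.asIdeal ↔ s = 0 ∨ Ideal.span {s} * p.asIdeal ∉ 𝒥 := by
  have hmul : ∀ x y, (x = 0 ∨ Ideal.span {x} * p.asIdeal ∉ 𝒥) →
      (x * y = 0 ∨ Ideal.span {x * y} * p.asIdeal ∉ 𝒥) := by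
    intro x y h
    by_contra! h'
    exact h.elim (left_ne_zero_of_mul h'.1) fun h => h (h𝒥.span_mul_mem_of_mul h'.1 h'.2)
  let I : Ideal R :=
    { carrier := {s | s = 0 ∨ Ideal.span {s} * p.asIdeal ∉ 𝒥}
      zero_mem' := Or.inl rfl
      smul_mem' := fun c x hx => by
        rw [smul_eq_mul, mul_comm]
        exact hmul x c hx
      add_mem' := fun {a b} ha hb => by
        rcases ValuationRing.dvd_total a b with ⟨c, rfl⟩ | ⟨c, rfl⟩
        · rw [show a + a * c = a * (1 + c) by ring]
          exact hmul a _ ha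
        · rw [show b * c + b = b * (c + 1) by ring]
          exact hmul b _ hb }
  refine ⟨⟨I, ⟨?_, fun {x y} hxy => ?_⟩⟩, fun s => Iff.rfl⟩
  · rw [Ne, Ideal.eq_top_iff_one]
    rintro (h | h)
    · exact one_ne_zero h
    · exact h (by simpa using hp)
  · by_contra! h
    have hx : ¬ (x = 0 ∨ _) := h.1
    have hy : ¬ (y = 0 ∨ _) := h.2
    have hxy : x * y = 0 ∨ _ := hxy
    push Not at hx hy
    exact hxy.elim (mul_ne_zero hx.1 hy.1) fun h => h (h𝒥.span_mul_mem_mul hx.1 hx.2 hy.2)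

theorem mem_lowerPrime (h𝒥 : IsIdealFamily 𝒥) {p : PrimeSpectrum R} (hp : p.asIdeal ∈ 𝒥) {s : R} :
    s ∈ (lowerPrime 𝒥 p).asIdeal ↔ s = 0 ∨ Ideal.span {s} * p.asIdeal ∉ 𝒥 := by
  have h := h𝒥.exists_lower hp
  rw [lowerPrime, dif_pos h]
  exact h.choose_spec s

theorem span_mul_mem (h𝒥 : IsIdealFamily 𝒥) {p : PrimeSpectrum R} (hp : p.asIdeal ∈ 𝒥) {s : R}
    (hs : s ∉ (lowerPrime 𝒥 p).asIdeal) : Ideal.span {s} * p.asIdeal ∈ 𝒥 := by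
  by_contra h
  exact hs ((h𝒥.mem_lowerPrime hp).2 (Or.inr h))

theorem lowerPrime_le_iff (h𝒥 : IsIdealFamily 𝒥) {p q : PrimeSpectrum R} (hp : p.asIdeal ∈ 𝒥) :
    lowerPrime 𝒥 p ≤ q ↔ ∀ s ∉ q.asIdeal, Ideal.span {s} * p.asIdeal ∈ 𝒥 := by
  constructor
  · exact fun h s hs => h𝒥.span_mul_mem hp fun h' => hs (h h')
  · intro h s hs
    rcases (h𝒥.mem_lowerPrime hp).1 hs with rfl | h'
    · exact zero_mem _
    · by_contra hsq
      exact h' (h s hsq)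

theorem lowerPrime_le (h𝒥 : IsIdealFamily 𝒥) {p : PrimeSpectrum R} (hp : p.asIdeal ∈ 𝒥) :
    lowerPrime 𝒥 p ≤ p :=
  (h𝒥.lowerPrime_le_iff hp).2 fun s hs => by rwa [span_mul_prime_of_notMem hs]

theorem mem_of_isSat (h𝒥 : IsIdealFamily 𝒥) {p : PrimeSpectrum R} (hp : p.asIdeal ∈ 𝒥)
    {J : Ideal R} (hJ : IsSat p J) (h : (lowerPrime 𝒥 p).asIdeal ≤ J) : J ∈ 𝒥 := by
  rw [hJ.eq_sInf]
  refine h𝒥.sInf_mem ?_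
  rintro _ ⟨x, hx, rfl⟩
  exact h𝒥.span_mul_mem hp fun hx' => hx (h hx')

theorem lowerPrime_mem (h𝒥 : IsIdealFamily 𝒥) {p : PrimeSpectrum R} (hp : p.asIdeal ∈ 𝒥) :
    (lowerPrime 𝒥 p).asIdeal ∈ 𝒥 :=
  h𝒥.mem_of_isSat hp (isSat_prime (h𝒥.lowerPrime_le hp)) le_rfl

/-- The attached prime of a proper ideal in the family belongs to the family, and its lower prime is
contained in the ideal. -/
theorem exists_attached (h𝒥 : IsIdealFamily 𝒥) {J : Ideal R} (hJ : J ∈ 𝒥) (hJt : J ≠ ⊤) :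
    ∃ p : PrimeSpectrum R, p.asIdeal ∈ 𝒥 ∧ IsSat p J ∧ (lowerPrime 𝒥 p).asIdeal ≤ J := by
  have h1 : (1 : R) ∉ J := fun h => hJt ((Ideal.eq_top_iff_one _).2 h)
  -- The union of the residuals `(J : z)` with `z ∉ J` is the attached prime `J^#`.
  let S : Set (Ideal R) := {I | ∃ z ∉ J, I = residual J z}
  have hS : S.Nonempty := ⟨_, 1, h1, rfl⟩
  have hmem : ∀ t, t ∈ sSup S ↔ ∃ z ∉ J, t * z ∈ J := by
    intro t
    rw [mem_sSup_ideals hS]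
    constructor
    · rintro ⟨_, ⟨z, hz, rfl⟩, h⟩
      exact ⟨z, hz, h⟩
    · rintro ⟨z, hz, h⟩
      exact ⟨_, ⟨z, hz, rfl⟩, h⟩
  have hprime : (sSup S).IsPrime := by
    refine ⟨fun h => ?_, fun {x y} hxy => ?_⟩
    · obtain ⟨z, hz, h⟩ := (hmem 1).1 (h ▸ Submodule.mem_top)
      exact hz (by simpa using h)
    · obtain ⟨z, hz, h⟩ := (hmem _).1 hxy
      by_cases hy : y * z ∈ J
      · exact Or.inr ((hmem _).2 ⟨z, hz, hy⟩)
      · exact Or.inl ((hmem _).2 ⟨y * z, hy, by rwa [← mul_assoc]⟩)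
  have hp : sSup S ∈ 𝒥 := h𝒥.sSup_mem (by
    rintro _ ⟨z, -, rfl⟩
    exact h𝒥.residual_mem hJ z) hS
  have hsat : IsSat ⟨sSup S, hprime⟩ J := fun s hs z hz => by
    by_contra hzJ
    exact hs ((hmem s).2 ⟨z, hzJ, hz⟩)
  refine ⟨⟨sSup S, hprime⟩, hp, hsat, fun s hs => ?_⟩
  by_contra hsJ
  have hne : {I | ∃ x, s * x ∉ J ∧ I = residual J x}.Nonempty := ⟨_, 1, by rwa [mul_one], rfl⟩
  -- For `s ∉ J` the ideal `s J^#` is again a union of residuals of `J`, hence in the family, so `s`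
  -- cannot lie in the lower prime of `J^#`.
  have key : Ideal.span {s} * sSup S = sSup {I | ∃ x, s * x ∉ J ∧ I = residual J x} := by
    apply le_antisymm
    · intro a ha
      obtain ⟨t, ht, rfl⟩ := Ideal.mem_span_singleton_mul.1 ha
      obtain ⟨z, hz, htz⟩ := (hmem t).1 ht
      rcases ValuationRing.dvd_total s z with ⟨x, rfl⟩ | ⟨w, rfl⟩
      · refine (mem_sSup_ideals hne).2 ⟨_, ⟨x, hz, rfl⟩, mem_residual.2 ?_⟩
        rwa [show s * t * x = t * (s * x) by ring]
      · refine (mem_sSup_ideals hne).2 ⟨_, ⟨1, by rwa [mul_one], rfl⟩, mem_residual.2 ?_⟩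
        rw [show z * w * t * 1 = t * z * w by ring]
        exact Ideal.mul_mem_right w J htz
    · refine sSup_le ?_
      rintro _ ⟨x, hx, rfl⟩
      exact (hsat.residual x).le_span_mul (by rwa [mem_residual])
  rcases (h𝒥.mem_lowerPrime (p := ⟨sSup S, hprime⟩) hp).1 hs with rfl | h
  · exact hsJ (zero_mem J)
  · refine h (key ▸ h𝒥.sSup_mem ?_ hne)
    rintro _ ⟨x, -, rfl⟩
    exact h𝒥.residual_mem hJ x

/-- If `s ∈ φ \ φ²`, then `s p` is obtained from `φ` by extension: for `a ∈ φ` with `s = a x` the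
residual is `x p`, and `x ∉ φ` because `s ∉ φ²`. Then `s p ∈ 𝒥` contradicts `s ∈ φ`. -/
theorem lowerPrime_idempotent (h𝒥 : IsIdealFamily 𝒥) {p : PrimeSpectrum R} (hp : p.asIdeal ∈ 𝒥) :
    (lowerPrime 𝒥 p).asIdeal = (lowerPrime 𝒥 p).asIdeal ^ 2 := by
  refine le_antisymm (fun s hs => ?_) (Ideal.pow_le_self two_ne_zero)
  by_contra hs2
  have hs0 : s ≠ 0 := by
    rintro rfl
    exact hs2 (zero_mem _)
  refine ((h𝒥.mem_lowerPrime hp).1 hs).elim hs0 fun h => h ?_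
  refine h𝒥.ext_mem (h𝒥.lowerPrime_mem hp) (Ideal.mul_le_left.trans
    ((Ideal.span_singleton_le_iff_mem _).2 hs)) fun a ha => ?_
  rcases ValuationRing.dvd_total s a with ⟨c, rfl⟩ | ⟨x, rfl⟩
  · rw [residual_span_mul hs0 _ rfl]
    exact h𝒥.residual_mem hp c
  · rw [residual_span_mul' (left_ne_zero_of_mul hs0) _ rfl]
    refine h𝒥.span_mul_mem hp fun hx => hs2 ?_
    rw [pow_two]
    exact Ideal.mul_mem_mul ha hx

/-- The key rigidity of `φ`. For `s ∉ φ(u)`, the ideal `s p` is `u`-saturated and contains `φ(u)`.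
For `s ∉ φ(p)`, extension closure is applied to `s u` inside the contraction of `s R_p`. -/
theorem lowerPrime_eq_of_le (h𝒥 : IsIdealFamily 𝒥) {p u : PrimeSpectrum R} (hp : p.asIdeal ∈ 𝒥)
    (hu : u.asIdeal ∈ 𝒥) (hpu : p ≤ u) (h : lowerPrime 𝒥 u ≤ p) :
    lowerPrime 𝒥 p = lowerPrime 𝒥 u := by
  apply le_antisymm
  · refine (h𝒥.lowerPrime_le_iff hp).2 fun s hs => ?_
    refine h𝒥.mem_of_isSat hu ((isSat_prime hpu).span_mul hpu s) fun a ha => ?_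
    rcases ValuationRing.dvd_total s a with ⟨c, rfl⟩ | ⟨c, rfl⟩
    · exact Ideal.mem_span_singleton_mul.2
        ⟨c, h (((lowerPrime 𝒥 u).2.mem_or_mem ha).resolve_left hs), rfl⟩
    · exact absurd (Ideal.mul_mem_right c _ ha) hs
  · refine (h𝒥.lowerPrime_le_iff hu).2 fun s hs => ?_
    have hs0 : s ≠ 0 := by
      rintro rfl
      exact hs (zero_mem _)
    -- The contraction of `s R_p` to `R`; it is `p`-saturated and contains `φ(p)`.
    let I : Ideal R :=
      { carrier := {r | ∃ t ∉ p.asIdeal, s ∣ t * r}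
        zero_mem' := ⟨1, fun h => p.2.ne_top ((Ideal.eq_top_iff_one _).2 h), by simp⟩
        smul_mem' := by
          rintro c x ⟨t, ht, h⟩
          refine ⟨t, ht, ?_⟩
          rw [smul_eq_mul, mul_left_comm]
          exact h.mul_left c
        add_mem' := by
          rintro a b ⟨t, ht, h⟩ ⟨t', ht', h'⟩
          refine ⟨t * t', fun h => (p.2.mem_or_mem h).elim ht ht', ?_⟩
          rw [show t * t' * (a + b) = t' * (t * a) + t * (t' * b) by ring]
          exact dvd_add (h.mul_left _) (h'.mul_left _) }
    have hI : I ∈ 𝒥 := by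
      refine h𝒥.mem_of_isSat hp ?_ fun a ha => ?_
      · rintro t ht z ⟨t', ht', hz⟩
        exact ⟨t' * t, fun h => (p.2.mem_or_mem h).elim ht' ht, by rwa [mul_assoc]⟩
      · refine ⟨1, fun h => p.2.ne_top ((Ideal.eq_top_iff_one _).2 h), ?_⟩
        rcases ValuationRing.dvd_total s a with hsa | ⟨c, rfl⟩
        · rwa [one_mul]
        · exact absurd (Ideal.mul_mem_right c _ ha) hs
    refine h𝒥.ext_mem hI (fun a ha => ?_) fun a ha => ?_
    · obtain ⟨c, -, rfl⟩ := Ideal.mem_span_singleton_mul.1 ha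
      exact ⟨1, fun h => p.2.ne_top ((Ideal.eq_top_iff_one _).2 h), by simp⟩
    · rcases ValuationRing.dvd_total s a with ⟨c, rfl⟩ | ⟨x, rfl⟩
      · rw [residual_span_mul hs0 _ rfl]
        exact h𝒥.residual_mem hu c
      · have ha0 := left_ne_zero_of_mul hs0
        rw [residual_span_mul' ha0 _ rfl]
        -- From `s = a x` and `t a = s y` follows `t = x y`; so `x ∈ φ(u) ≤ p` would put `t` into
        -- `p`.
        obtain ⟨t, ht, y, hy⟩ := ha
        refine h𝒥.span_mul_mem hu fun hx => ht ?_
        have : t = x * y := mul_left_cancel₀ ha0 (by rw [mul_comm a t, hy]; ring)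
        rw [this]
        exact Ideal.mul_mem_right y _ (h hx)

theorem lowerPrime_mono (h𝒥 : IsIdealFamily 𝒥) {p u : PrimeSpectrum R} (hp : p.asIdeal ∈ 𝒥)
    (hu : u.asIdeal ∈ 𝒥) (hpu : p ≤ u) : lowerPrime 𝒥 p ≤ lowerPrime 𝒥 u := by
  rcases primes_le_total (lowerPrime 𝒥 u) p with h | h
  · exact (h𝒥.lowerPrime_eq_of_le hp hu hpu h).le
  · exact (h𝒥.lowerPrime_le hp).trans h

theorem lowerPrime_lowerPrime (h𝒥 : IsIdealFamily 𝒥) {p : PrimeSpectrum R} (hp : p.asIdeal ∈ 𝒥) :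
    lowerPrime 𝒥 (lowerPrime 𝒥 p) = lowerPrime 𝒥 p :=
  h𝒥.lowerPrime_eq_of_le (h𝒥.lowerPrime_mem hp) hp (h𝒥.lowerPrime_le hp) le_rfl

end IsIdealFamily

theorem exists_prime_sSup [ValuationRing R] {Y : Set (PrimeSpectrum R)} (hY : Y.Nonempty) :
    ∃ P : PrimeSpectrum R, P.asIdeal = sSup (PrimeSpectrum.asIdeal '' Y) ∧
      ∀ x, x ∈ P.asIdeal ↔ ∃ p ∈ Y, x ∈ p.asIdeal := by
  have hmem : ∀ x, x ∈ sSup (PrimeSpectrum.asIdeal '' Y) ↔ ∃ p ∈ Y, x ∈ p.asIdeal := by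
    intro x
    rw [mem_sSup_ideals (hY.image _)]
    simp
  refine ⟨⟨_, ⟨fun h => ?_, fun {x y} hxy => ?_⟩⟩, rfl, hmem⟩
  · obtain ⟨p, -, hp⟩ := (hmem 1).1 (h ▸ Submodule.mem_top)
    exact p.2.ne_top ((Ideal.eq_top_iff_one _).2 hp)
  · obtain ⟨p, hpY, hp⟩ := (hmem _).1 hxy
    exact (p.2.mem_or_mem hp).imp (fun h => (hmem _).2 ⟨p, hpY, h⟩)
      fun h => (hmem _).2 ⟨p, hpY, h⟩

theorem exists_prime_sInf [ValuationRing R] {Y : Set (PrimeSpectrum R)} (hY : Y.Nonempty) :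
    ∃ P : PrimeSpectrum R, P.asIdeal = sInf (PrimeSpectrum.asIdeal '' Y) ∧
      ∀ x, x ∈ P.asIdeal ↔ ∀ p ∈ Y, x ∈ p.asIdeal := by
  have hmem : ∀ x, x ∈ sInf (PrimeSpectrum.asIdeal '' Y) ↔ ∀ p ∈ Y, x ∈ p.asIdeal := by
    intro x
    simp [Submodule.mem_sInf]
  refine ⟨⟨_, ⟨fun h => ?_, fun {x y} hxy => ?_⟩⟩, rfl, hmem⟩
  · obtain ⟨p, hp⟩ := hY
    exact p.2.ne_top ((Ideal.eq_top_iff_one _).2 ((hmem 1).1 (h ▸ Submodule.mem_top) p hp))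
  · by_contra! h
    simp only [hmem, not_forall] at h
    obtain ⟨⟨p, hp, hxp⟩, q, hq, hyq⟩ := h
    rcases primes_le_total p q with hpq | hpq
    · exact ((p.2.mem_or_mem ((hmem _).1 hxy p hp)).resolve_left hxp) |> fun h => hyq (hpq h)
    · exact ((q.2.mem_or_mem ((hmem _).1 hxy q hq)).resolve_right hyq) |> fun h => hxp (hpq h)

/-- The system of intervals attached to an ideal family. -/
def systemOfFamily (𝒥 : Set (Ideal R)) : Set (SpecInterval R) :=
  {χ | IsGreatest {u : PrimeSpectrum R | u.asIdeal ∈ 𝒥 ∧ lowerPrime 𝒥 u ≤ χ.lower} χ.upper ∧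
    lowerPrime 𝒥 χ.upper = χ.lower}

namespace IsIdealFamily

variable [ValuationRing R]

/-- The union `U` of all candidates is itself one, since `s U` is the union of the ideals `s u`. -/
theorem exists_isGreatest (h𝒥 : IsIdealFamily 𝒥) {p : PrimeSpectrum R} (hp : p.asIdeal ∈ 𝒥) :
    ∃ U, IsGreatest {u : PrimeSpectrum R | u.asIdeal ∈ 𝒥 ∧ lowerPrime 𝒥 u ≤ lowerPrime 𝒥 p} U := by
  set Y := {u : PrimeSpectrum R | u.asIdeal ∈ 𝒥 ∧ lowerPrime 𝒥 u ≤ lowerPrime 𝒥 p}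
  have hY : Y.Nonempty := ⟨p, hp, le_rfl⟩
  obtain ⟨U, hU, hmem⟩ := exists_prime_sSup hY
  have hU𝒥 : U.asIdeal ∈ 𝒥 := by
    rw [hU]
    refine h𝒥.sSup_mem ?_ (hY.image _)
    rintro _ ⟨u, hu, rfl⟩
    exact hu.1
  refine ⟨U, ⟨hU𝒥, (h𝒥.lowerPrime_le_iff hU𝒥).2 fun s hs => ?_⟩,
    fun u hu x hx => (hmem x).2 ⟨u, hu, hx⟩⟩
  have e : Ideal.span {s} * U.asIdeal =
      sSup ((fun u : PrimeSpectrum R => Ideal.span {s} * u.asIdeal) '' Y) := by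
    ext x
    rw [mem_sSup_ideals (hY.image _)]
    constructor
    · intro hx
      obtain ⟨z, hz, rfl⟩ := Ideal.mem_span_singleton_mul.1 hx
      obtain ⟨u, hu, hzu⟩ := (hmem z).1 hz
      exact ⟨_, ⟨u, hu, rfl⟩, Ideal.mem_span_singleton_mul.2 ⟨z, hzu, rfl⟩⟩
    · rintro ⟨_, ⟨u, hu, rfl⟩, hx⟩
      obtain ⟨z, hz, rfl⟩ := Ideal.mem_span_singleton_mul.1 hx
      exact Ideal.mem_span_singleton_mul.2 ⟨z, (hmem z).2 ⟨u, hu, hz⟩, rfl⟩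
  rw [e]
  refine h𝒥.sSup_mem ?_ (hY.image _)
  rintro _ ⟨u, hu, rfl⟩
  exact (h𝒥.lowerPrime_le_iff hu.1).1 hu.2 s hs

theorem exists_interval (h𝒥 : IsIdealFamily 𝒥) {p : PrimeSpectrum R} (hp : p.asIdeal ∈ 𝒥) :
    ∃ χ ∈ systemOfFamily 𝒥, χ.lower = lowerPrime 𝒥 p ∧ p ≤ χ.upper := by
  obtain ⟨U, hU⟩ := h𝒥.exists_isGreatest hp
  have hpU : p ≤ U := hU.2 ⟨hp, le_rfl⟩
  have h := h𝒥.lowerPrime_eq_of_le hp hU.1.1 hpU (hU.1.2.trans (h𝒥.lowerPrime_le hp))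
  exact ⟨⟨lowerPrime 𝒥 p, U, (h𝒥.lowerPrime_le hp).trans hpU⟩, ⟨hU, h.symm⟩, rfl, hpU⟩

theorem mem_iff (h𝒥 : IsIdealFamily 𝒥) {I : Ideal R} (hI : I ≠ ⊤) :
    I ∈ 𝒥 ↔ ∃ χ ∈ systemOfFamily 𝒥, I ∈ χ.ideals := by
  constructor
  · intro h
    obtain ⟨p, hp, hsat, hle⟩ := h𝒥.exists_attached h hI
    obtain ⟨χ, hχ, e, hpχ⟩ := h𝒥.exists_interval hp
    exact ⟨χ, hχ, SpecInterval.mem_ideals.2 ⟨hI, e ▸ hle, hsat.mono hpχ⟩⟩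
  · rintro ⟨χ, ⟨hχ, e⟩, h⟩
    obtain ⟨-, h1, h2⟩ := SpecInterval.mem_ideals.1 h
    exact h𝒥.mem_of_isSat hχ.1.1 h2 (e ▸ h1)

theorem isAdmissible (h𝒥 : IsIdealFamily 𝒥) : IsAdmissible (systemOfFamily 𝒥) where
  disjoint χ hχ ξ hξ hne hle := by
    by_contra hlt
    have h1 : ξ.lower ≤ χ.upper := (primes_le_total _ _).elim id fun h =>
      (eq_or_lt_of_le h).elim (fun h => h.ge) fun h => absurd h hlt
    -- Overlapping intervals have the same lower end by monotonicity and rigidity of `φ`; the upper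
    -- end is then determined as a greatest element.
    have heq : χ.lower = ξ.lower := by
      rcases primes_le_total ξ.upper χ.upper with h | h
      · refine le_antisymm hle ?_
        rw [← hξ.2, ← hχ.2]
        exact h𝒥.lowerPrime_mono hξ.1.1.1 hχ.1.1.1 h
      · rw [← hξ.2, ← hχ.2]
        exact h𝒥.lowerPrime_eq_of_le hχ.1.1.1 hξ.1.1.1 h (hξ.2 ▸ h1)
    refine hne (SpecInterval.ext heq (hχ.1.unique ?_))
    rw [heq]
    exact hξ.1
  idempotent χ hχ := by
    rw [← hχ.2]
    exact h𝒥.lowerPrime_idempotent hχ.1.1.1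
  complete Y hYX hY := by
    constructor
    · obtain ⟨P, hP, hmem⟩ := exists_prime_sSup (hY.image SpecInterval.lower)
      have hP𝒥 : P.asIdeal ∈ 𝒥 := by
        rw [hP]
        refine h𝒥.sSup_mem ?_ ((hY.image _).image _)
        rintro _ ⟨_, ⟨χ, hχ, rfl⟩, rfl⟩
        rw [← (hYX hχ).2]
        exact h𝒥.lowerPrime_mem (hYX hχ).1.1.1
      -- Lower ends are fixed points of the monotone map `φ`, and so is a union of them.
      have hlow : lowerPrime 𝒥 P = P := by
        refine le_antisymm (h𝒥.lowerPrime_le hP𝒥) fun x hx => ?_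
        obtain ⟨_, ⟨χ, hχ, rfl⟩, hxχ⟩ := (hmem x).1 hx
        have hχ' := hYX hχ
        have : χ.lower ≤ lowerPrime 𝒥 P := by
          have e : lowerPrime 𝒥 χ.lower = χ.lower := by
            rw [← hχ'.2, h𝒥.lowerPrime_lowerPrime hχ'.1.1.1]
          rw [← e]
          refine h𝒥.lowerPrime_mono ?_ hP𝒥 fun y hy => (hmem y).2 ⟨_, ⟨χ, hχ, rfl⟩, hy⟩
          rw [← hχ'.2]
          exact h𝒥.lowerPrime_mem hχ'.1.1.1
        exact this hxχ
      obtain ⟨μ, hμ, e, -⟩ := h𝒥.exists_interval hP𝒥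
      refine ⟨μ, hμ, ?_⟩
      ext x
      rw [e, hlow]
      simp [hmem]
    · obtain ⟨P, hP, hmem⟩ := exists_prime_sInf (hY.image SpecInterval.upper)
      have hP𝒥 : P.asIdeal ∈ 𝒥 := by
        rw [hP]
        refine h𝒥.sInf_mem ?_
        rintro _ ⟨_, ⟨χ, hχ, rfl⟩, rfl⟩
        exact (hYX hχ).1.1.1
      obtain ⟨ν, hν, e, hPν⟩ := h𝒥.exists_interval hP𝒥
      -- If `ν.upper` exceeded some `χ.upper`, it would still satisfy `φ(ν.upper) = φ(P) ≤ χ.lower`,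
      -- against the maximality of `χ.upper`.
      have hup : ν.upper = P := by
        refine le_antisymm (fun x hx => (hmem x).2 ?_) hPν
        rintro _ ⟨χ, hχ, rfl⟩
        have hχ' := hYX hχ
        rcases primes_le_total ν.upper χ.upper with h | h
        · exact h hx
        · refine hχ'.1.2 ⟨hν.1.1.1, ?_⟩ hx
          rw [hν.2, e, ← hχ'.2]
          exact h𝒥.lowerPrime_mono hP𝒥 hχ'.1.1.1 fun y hy => (hmem y).1 hy _ ⟨χ, hχ, rfl⟩
      refine ⟨ν, hν, ?_⟩
      ext x
      rw [hup]
      simp [hmem]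

end IsIdealFamily

/-- The ideals described by a system of intervals, together with the unit ideal. -/
def idealsOfSystem (X : Set (SpecInterval R)) : Set (Ideal R) :=
  {I | I ≠ ⊤ → ∃ χ ∈ X, I ∈ χ.ideals}

theorem IsAdmissible.eq_of_mem {X : Set (SpecInterval R)} [ValuationRing R] (hX : IsAdmissible X)
    {χ ξ : SpecInterval R} (hχ : χ ∈ X) (hξ : ξ ∈ X) {P : PrimeSpectrum R}
    (h1 : χ.lower ≤ P) (h2 : P ≤ χ.upper) (h3 : ξ.lower ≤ P) (h4 : P ≤ ξ.upper) : χ = ξ := by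
  by_contra hne
  rcases primes_le_total χ.lower ξ.lower with h | h
  · exact absurd (h3.trans h2) (hX.disjoint χ hχ ξ hξ hne h).not_ge
  · exact absurd (h1.trans h4) (hX.disjoint ξ hξ χ hχ (Ne.symm hne) h).not_ge

theorem prime_mem_idealsOfSystem {X : Set (SpecInterval R)} [ValuationRing R]
    {P : PrimeSpectrum R} :
    P.asIdeal ∈ idealsOfSystem X ↔ ∃ χ ∈ X, χ.lower ≤ P ∧ P ≤ χ.upper := by
  refine ⟨fun h => ?_, ?_⟩
  · obtain ⟨χ, hχ, h⟩ := h P.2.ne_top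
    obtain ⟨-, h1, h2⟩ := SpecInterval.mem_ideals.1 h
    exact ⟨χ, hχ, h1, h2.le P.2.ne_top⟩
  · rintro ⟨χ, hχ, h1, h2⟩ -
    exact ⟨χ, hχ, SpecInterval.mem_ideals.2 ⟨P.2.ne_top, h1, isSat_prime h2⟩⟩

/-- If `s P` belonged to the family for a nonzero `s ∈ χ.lower`, an interval accounting for it would
contain `P`, hence be `χ` by disjointness. Then `s ∈ χ.lower ≤ s P`, which is impossible. -/
theorem IsAdmissible.lowerPrime_eq {X : Set (SpecInterval R)} [ValuationRing R]
    (hX : IsAdmissible X) (h𝒥 : IsIdealFamily (idealsOfSystem X)) {χ : SpecInterval R} (hχ : χ ∈ X)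
    {P : PrimeSpectrum R} (h1 : χ.lower ≤ P) (h2 : P ≤ χ.upper) :
    lowerPrime (idealsOfSystem X) P = χ.lower := by
  have hP : P.asIdeal ∈ idealsOfSystem X := prime_mem_idealsOfSystem.2 ⟨χ, hχ, h1, h2⟩
  apply le_antisymm
  · refine (h𝒥.lowerPrime_le_iff hP).2 fun s hs ht => ⟨χ, hχ, SpecInterval.mem_ideals.2 ⟨ht, ?_,
      ((isSat_prime le_rfl).span_mul le_rfl s).mono h2⟩⟩
    rw [← span_mul_prime_of_notMem hs]
    exact Ideal.mul_mono_right h1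
  · intro s hs
    refine (h𝒥.mem_lowerPrime hP).2 (or_iff_not_imp_left.2 fun hs0 hmem => ?_)
    have hne : Ideal.span {s} * P.asIdeal ≠ ⊤ := fun h =>
      P.2.ne_top (top_le_iff.1 (h ▸ Ideal.mul_le_right))
    obtain ⟨ξ, hξ, h⟩ := hmem hne
    obtain ⟨-, h3, h4⟩ := SpecInterval.mem_ideals.1 h
    have h5 : ξ.lower ≤ P := h3.trans Ideal.mul_le_right
    have h6 : P ≤ ξ.upper := by
      intro t ht
      by_contra htξ
      exact notMem_span_mul_self hs0
        (h4 t htξ s (Ideal.mem_span_singleton_mul.2 ⟨t, ht, mul_comm s t⟩))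
    obtain rfl := hX.eq_of_mem hχ hξ h1 h2 h5 h6
    exact notMem_span_mul_self hs0 (h3 hs)

theorem IsAdmissible.systemOfFamily_eq {X : Set (SpecInterval R)} [ValuationRing R]
    (hX : IsAdmissible X) (h𝒥 : IsIdealFamily (idealsOfSystem X)) :
    systemOfFamily (idealsOfSystem X) = X := by
  have hsub : X ⊆ systemOfFamily (idealsOfSystem X) := by
    intro χ hχ
    have e := hX.lowerPrime_eq h𝒥 hχ χ.lower_le_upper le_rfl
    refine ⟨⟨⟨prime_mem_idealsOfSystem.2 ⟨χ, hχ, χ.lower_le_upper, le_rfl⟩, e.le⟩, ?_⟩, e⟩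
    rintro u ⟨hu, hle⟩
    obtain ⟨ξ, hξ, h1, h2⟩ := prime_mem_idealsOfSystem.1 hu
    rw [hX.lowerPrime_eq h𝒥 hξ h1 h2] at hle
    by_cases hne : ξ = χ
    · exact hne ▸ h2
    · exact h2.trans ((hX.disjoint ξ hξ χ hχ hne hle).le.trans χ.lower_le_upper)
  refine Set.Subset.antisymm (fun χ hχ => ?_) hsub
  obtain ⟨ξ, hξ, h1, h2⟩ := prime_mem_idealsOfSystem.1 hχ.1.1.1
  have e := hX.lowerPrime_eq h𝒥 hξ h1 h2
  rw [hχ.2] at e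
  have hξ' := (hsub hξ).1
  rw [← e] at hξ'
  have : χ = ξ := SpecInterval.ext e (hχ.1.unique hξ')
  exact this ▸ hξ

end Families

end Cosilting

namespace Cosilting

/-! ### Limit closed classes are determined by their cyclic modules. -/

section GoodClasses

variable {R : Type u} [CommRing R]

/-- Classes of modules closed under submodules, products, extensions, and suitable direct limits of
quotients. -/
structure IsLimitClosed (C : ObjectProperty (ModuleCat.{u} R)) : Prop where
  of_injective : ∀ {M N : Type u} [AddCommGroup M] [Module R M] [AddCommGroup N] [Module R N]
    (f : M →ₗ[R] N), Function.Injective f → C (ModuleCat.of R N) → C (ModuleCat.of R M)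
  pi : ∀ {I : Type u} (M : I → Type u) [∀ i, AddCommGroup (M i)] [∀ i, Module R (M i)],
    (∀ i, C (ModuleCat.of R (M i))) → C (ModuleCat.of R (∀ i, M i))
  extension : ∀ {M : Type u} [AddCommGroup M] [Module R M] (N : Submodule R M),
    C (ModuleCat.of R N) → C (ModuleCat.of R (M ⧸ N)) → C (ModuleCat.of R M)
  quotient_iSup : ∀ {M : Type u} [AddCommGroup M] [Module R M] {ι : Type u} [LinearOrder ι]
    [WellFoundedLT ι] [NoMaxOrder ι] [Nonempty ι] (N : ι → Submodule R M), Monotone N →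
    (∀ j, C (ModuleCat.of R (M ⧸ N j))) → C (ModuleCat.of R (M ⧸ ⨆ j, N j))

/-- The ideals `I` with `R ⧸ I` in the class. -/
def cyclicIdeals (C : ObjectProperty (ModuleCat.{u} R)) : Set (Ideal R) :=
  {I | C (ModuleCat.of R (R ⧸ I))}

variable {C : ObjectProperty (ModuleCat.{u} R)}

namespace IsLimitClosed

variable {M N : Type u} [AddCommGroup M] [Module R M] [AddCommGroup N] [Module R N]

theorem quotient (hC : IsLimitClosed C) (f : M →ₗ[R] N) {K : Submodule R M}
    (hK : K = LinearMap.ker f) (hN : C (ModuleCat.of R N)) : C (ModuleCat.of R (M ⧸ K)) :=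
  hC.of_injective (K.liftQ f hK.le)
    (LinearMap.ker_eq_bot.1 (Submodule.ker_liftQ_eq_bot' _ _ hK)) hN

theorem of_subsingleton (hC : IsLimitClosed C) [Subsingleton M] : C (ModuleCat.of R M) :=
  hC.of_injective (N := ∀ _ : PEmpty.{u + 1}, PUnit.{u + 1}) 0 (Function.injective_of_subsingleton _)
    (hC.pi _ fun i => i.elim)

theorem quotient_sSup (hC : IsLimitClosed C) {S : Set (Submodule R M)} (hS : S.Nonempty)
    (hchain : ∀ I ∈ S, ∀ J ∈ S, I ≤ J ∨ J ≤ I) (h : ∀ I ∈ S, C (ModuleCat.of R (M ⧸ I))) :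
    C (ModuleCat.of R (M ⧸ sSup S)) := by
  classical
  by_cases hmax : ∃ I ∈ S, ∀ J ∈ S, J ≤ I
  · obtain ⟨I, hI, hmax⟩ := hmax
    have : sSup S = I := le_antisymm (sSup_le hmax) (le_sSup hI)
    rw [this]
    exact h I hI
  push Not at hmax
  let r : Submodule R M → Submodule R M → Prop := WellOrderingRel
  have hwf : WellFounded r := WellOrderingRel.isWellOrder.wf
  -- The members larger than everything preceding them in a chosen well-order form a cofinal subset
  -- on which inclusion is a well-order.
  let T : Set (Submodule R M) := {y | y ∈ S ∧ ∀ z ∈ S, r z y → z < y}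
  have hcof : ∀ I ∈ S, ∃ J ∈ T, I ≤ J := by
    intro I hI
    obtain ⟨J, ⟨hJ, hIJ⟩, hmin⟩ := hwf.has_min {J | J ∈ S ∧ I ≤ J} ⟨I, hI, le_rfl⟩
    refine ⟨J, ⟨hJ, fun z hz hzJ => ?_⟩, hIJ⟩
    have : ¬ I ≤ z := fun hIz => hmin z ⟨hz, hIz⟩ hzJ
    exact lt_of_lt_of_le (lt_of_le_not_ge ((hchain I hI z hz).resolve_left this) this) hIJ
  let _ : LinearOrder T :=
    { (inferInstance : PartialOrder T) with
      le_total := fun a b => hchain a a.2.1 b b.2.1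
      toDecidableLE := Classical.decRel _ }
  have : WellFoundedLT T := ⟨Subrelation.wf (r := fun a b : T => r a b) (fun {a b} hab => by
    by_contra hr
    by_cases hr' : r b a
    · exact absurd (a.2.2 b b.2.1 hr') (not_lt_of_gt hab)
    · exact hab.ne (Subtype.ext (WellOrderingRel.isWellOrder.trichotomous (r := r) _ _ hr hr'))) (InvImage.wf _ hwf)⟩
  have : NoMaxOrder T := ⟨fun a => by
    obtain ⟨J, hJ, hJa⟩ := hmax a a.2.1
    obtain ⟨K, hK, hJK⟩ := hcof J hJ
    have hlt : a.1 < K := lt_of_lt_of_le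
      (lt_of_le_not_ge ((hchain a a.2.1 J hJ).resolve_right hJa) hJa) hJK
    exact ⟨⟨K, hK⟩, hlt⟩⟩
  have : Nonempty T := by
    obtain ⟨I, hI⟩ := hS
    obtain ⟨J, hJ, -⟩ := hcof I hI
    exact ⟨⟨J, hJ⟩⟩
  have e : sSup S = ⨆ j : T, j.1 := by
    apply le_antisymm
    · refine sSup_le fun I hI => ?_
      obtain ⟨J, hJ, hIJ⟩ := hcof I hI
      exact hIJ.trans (le_iSup (fun j : T => j.1) ⟨J, hJ⟩)
    · exact iSup_le fun j => le_sSup j.2.1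
  rw [e]
  exact hC.quotient_iSup _ (fun a b hab => hab) fun j => h j j.2.1

/-- The union embeds into the product of the `N j` modulo eventually vanishing families. That
reduced product is a chain quotient: killing the families that vanish from `j` on leaves `∏ i ≥ j, N
i`. -/
theorem iSup_mem (hC : IsLimitClosed C) {ι : Type u} [LinearOrder ι] [WellFoundedLT ι]
    [NoMaxOrder ι] [Nonempty ι] (N : ι → Submodule R M) (hN : Monotone N)
    (h : ∀ j, C (ModuleCat.of R (N j))) : C (ModuleCat.of R ↥(⨆ j, N j)) := by
  classical
  let K : ι → Submodule R (∀ j, N j) := fun j => ⨅ i : Set.Ici j, LinearMap.ker (LinearMap.proj i.1)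
  have memK : ∀ j f, f ∈ K j ↔ ∀ i, j ≤ i → f i = 0 := by
    intro j f
    simp [K, Submodule.mem_iInf]
  have hK : Monotone K := fun a b hab f hf => (memK _ _).2 fun i hi => (memK _ _).1 hf i (hab.trans hi)
  have memK' : ∀ f, f ∈ ⨆ j, K j ↔ ∃ j, ∀ i, j ≤ i → f i = 0 := by
    intro f
    rw [Submodule.mem_iSup_of_directed _ hK.directed_le]
    simp only [memK]
  have hP : C (ModuleCat.of R ((∀ j, N j) ⧸ ⨆ j, K j)) := by
    refine hC.quotient_iSup K hK fun j => ?_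
    refine hC.quotient (N := ∀ i : Set.Ici j, N i) (LinearMap.pi fun i => LinearMap.proj i.1) ?_
      (hC.pi _ fun i => h i)
    ext f
    rw [memK, LinearMap.mem_ker, funext_iff]
    simp
  have memN : ∀ m, m ∈ ⨆ j, N j ↔ ∃ j, m ∈ N j := fun m =>
    Submodule.mem_iSup_of_directed _ hN.directed_le
  -- The default `0` is used only before `m` enters the chain, so `F` becomes linear modulo
  -- eventually vanishing families.
  let F : M → ∀ j, N j := fun m j => if hm : m ∈ N j then ⟨m, hm⟩ else 0
  have hF : ∀ {m j}, m ∈ N j → F m j = m := fun {m j} hm => by simp [F, hm]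
  let G : ↥(⨆ j, N j) →ₗ[R] (∀ j, N j) ⧸ ⨆ j, K j :=
    { toFun := fun m => Submodule.Quotient.mk (F m)
      map_add' := fun x y => by
        rw [← Submodule.Quotient.mk_add, Submodule.Quotient.eq, memK']
        obtain ⟨a, ha⟩ := (memN _).1 x.2
        obtain ⟨b, hb⟩ := (memN _).1 y.2
        refine ⟨max a b, fun i hi => Subtype.ext ?_⟩
        have hx := hN ((le_max_left _ _).trans hi) ha
        have hy := hN ((le_max_right _ _).trans hi) hb
        simp [hF hx, hF hy, hF (add_mem hx hy)]
      map_smul' := fun r x => by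
        rw [← Submodule.Quotient.mk_smul, Submodule.Quotient.eq, memK']
        obtain ⟨a, ha⟩ := (memN _).1 x.2
        refine ⟨a, fun i hi => Subtype.ext ?_⟩
        have hx := hN hi ha
        simp [hF hx, hF (Submodule.smul_mem _ r hx)] }
  refine hC.of_injective G ((injective_iff_map_eq_zero G).2 fun x hx => Subtype.ext ?_) hP
  obtain ⟨j, hj⟩ := (memK' _).1 ((Submodule.Quotient.mk_eq_zero _).1 hx)
  obtain ⟨a, ha⟩ := (memN _).1 x.2
  have := hj (max a j) (le_max_right _ _)
  have h2 := hF (hN (le_max_left a j) ha)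
  rw [this] at h2
  exact h2.symm

theorem torsionOf_mem (hC : IsLimitClosed C) (hM : C (ModuleCat.of R M)) (m : M) :
    Ideal.torsionOf R M m ∈ cyclicIdeals C :=
  hC.quotient (LinearMap.toSpanSingleton R M m) rfl hM

theorem span_singleton_mem (hC : IsLimitClosed C) {m : M}
    (h : Ideal.torsionOf R M m ∈ cyclicIdeals C) : C (ModuleCat.of R (R ∙ m)) :=
  hC.of_injective (Ideal.quotTorsionOfEquivSpanSingleton R M m).symm.toLinearMap
    (LinearEquiv.injective _) h

theorem torsionOf_coe {N : Submodule R M} (m : N) :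
    Ideal.torsionOf R N m = Ideal.torsionOf R M (m : M) := by
  ext r
  simp [Ideal.mem_torsionOf_iff, Subtype.ext_iff]

variable [IsDomain R] [ValuationRing R]

/-- Over a valuation domain, every nonzero finitely generated module has an element of every
generating set that generates a pure submodule and has minimal annihilator. -/
theorem exists_pure_generator [Nontrivial M] (S : Finset M) (hS : Submodule.span R (S : Set M) = ⊤) :
    ∃ x ∈ S, ∀ b : R, b • x ∈ IsLocalRing.maximalIdeal R • LinearMap.range (LinearMap.lsmul R M b) →
      ∀ y : M, b • y = 0 := by
  classical
  by_contra! hcon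
  -- If every generator fails through some scalar, the failing scalars merge into one: of two, the
  -- multiple works for both.
  have key : ∀ T : Finset M, T ⊆ S → ∃ b : R, (∃ y : M, b • y ≠ 0) ∧
      ∀ x ∈ T, b • x ∈ IsLocalRing.maximalIdeal R • LinearMap.range (LinearMap.lsmul R M b) := by
    intro T
    induction T using Finset.induction with
    | empty =>
      intro _
      obtain ⟨y, hy⟩ := exists_ne (0 : M)
      exact ⟨1, ⟨y, by simpa using hy⟩, by simp⟩
    | insert x T _ ih =>
      intro hT
      obtain ⟨b, hb, hbT⟩ := ih ((Finset.subset_insert _ _).trans hT)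
      obtain ⟨d, hd, y, hy⟩ := hcon x (hT (Finset.mem_insert_self _ _))
      have mul : ∀ (a e : R) (x : M),
          a • x ∈ IsLocalRing.maximalIdeal R • LinearMap.range (LinearMap.lsmul R M a) →
          (a * e) • x ∈
            IsLocalRing.maximalIdeal R • LinearMap.range (LinearMap.lsmul R M (a * e)) := by
        intro a e x h
        have h' := Submodule.mem_map_of_mem (f := LinearMap.lsmul R M e) h
        rw [Submodule.map_smul'', ← LinearMap.range_comp] at h'
        have e1 : LinearMap.lsmul R M e ∘ₗ LinearMap.lsmul R M a = LinearMap.lsmul R M (e * a) := by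
          ext z
          simp [mul_smul, smul_comm e a z]
        rw [e1] at h'
        rwa [LinearMap.lsmul_apply, ← mul_smul, mul_comm e a] at h'
      rcases ValuationRing.dvd_total b d with ⟨e, rfl⟩ | ⟨e, rfl⟩
      · refine ⟨b * e, ⟨y, hy⟩, fun z hz => ?_⟩
        rcases Finset.mem_insert.1 hz with rfl | hz
        · exact hd
        · exact mul b e z (hbT z hz)
      · refine ⟨d * e, hb, fun z hz => ?_⟩
        rcases Finset.mem_insert.1 hz with rfl | hz
        · exact mul d e z hd
        · exact hbT z hz
  obtain ⟨b, ⟨y, hy⟩, hb⟩ := key S subset_rfl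
  have hfin : Module.Finite R M := ⟨⟨S, hS⟩⟩
  -- The common scalar `b` gives `b M = 𝔪 b M`, and Nakayama yields `b M = 0`, a contradiction.
  have hle : LinearMap.range (LinearMap.lsmul R M b) ≤
      IsLocalRing.maximalIdeal R • LinearMap.range (LinearMap.lsmul R M b) := by
    rw [LinearMap.range_eq_map, ← hS, Submodule.map_span, Submodule.span_le]
    rintro _ ⟨x, hx, rfl⟩
    have := hb x hx
    rwa [LinearMap.range_eq_map, ← hS, Submodule.map_span] at this
  have hbot := Submodule.eq_bot_of_le_smul_of_le_jacobson_bot _ _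
    (by rw [LinearMap.range_eq_map]; exact hfin.1.map _) hle
    (IsLocalRing.jacobson_eq_maximalIdeal ⊥ bot_ne_top).ge
  have : b • y ∈ (⊥ : Submodule R M) := hbot ▸ ⟨y, rfl⟩
  exact hy (by simpa using this)

/-- Induction on the number of generators, dividing out the pure cyclic submodule `R x`. Purity
makes the annihilator of the class of `y` the union of the chain of annihilators of the lifts `y - a
x`, so the hypothesis passes to the quotient. -/
theorem of_finite_span (hC : IsLimitClosed C) (n : ℕ) : ∀ (M : Type u) [AddCommGroup M] [Module R M],
    (∀ m : M, Ideal.torsionOf R M m ∈ cyclicIdeals C) →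
    ∀ S : Finset M, S.card ≤ n → Submodule.span R (S : Set M) = ⊤ → C (ModuleCat.of R M) := by
  classical
  induction n with
  | zero =>
    intro M _ _ _ S hS hspan
    have : S = ∅ := by simpa using hS
    subst this
    have : Subsingleton M := (Submodule.subsingleton_iff R).1
      (subsingleton_of_bot_eq_top (by simpa using hspan))
    exact hC.of_subsingleton
  | succ n ih =>
    intro M _ _ hM S hS hspan
    rcases subsingleton_or_nontrivial M with _ | _
    · exact hC.of_subsingleton
    obtain ⟨x, hx, hpure⟩ := exists_pure_generator S hspan
    refine hC.extension (R ∙ x) (hC.span_singleton_mem (hM x)) ?_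
    refine ih (M ⧸ (R ∙ x)) (fun m => ?_) ((S.erase x).image (Submodule.mkQ (R ∙ x)))
      (Finset.card_image_le.trans (by rw [Finset.card_erase_of_mem hx]; omega)) ?_
    · obtain ⟨y, rfl⟩ := Submodule.mkQ_surjective _ m
      have e : Ideal.torsionOf R (M ⧸ (R ∙ x)) (Submodule.mkQ (R ∙ x) y) =
          sSup (Set.range fun a : R => Ideal.torsionOf R M (y - a • x)) := by
        ext r
        rw [mem_sSup_ideals (Set.range_nonempty _), Ideal.mem_torsionOf_iff, ← map_smul,
          Submodule.mkQ_apply, Submodule.Quotient.mk_eq_zero, Submodule.mem_span_singleton]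
        simp only [Set.exists_range_iff, Ideal.mem_torsionOf_iff]
        constructor
        · rintro ⟨b, hb⟩
          rcases ValuationRing.dvd_total r b with ⟨a, rfl⟩ | ⟨c, rfl⟩
          · exact ⟨a, by rw [smul_sub, ← mul_smul, hb, sub_self]⟩
          · by_cases hc : IsUnit c
            · obtain ⟨c, rfl⟩ := hc
              refine ⟨↑c⁻¹, ?_⟩
              rw [smul_sub, ← hb, ← mul_smul, mul_assoc, Units.mul_inv, mul_one, sub_self]
            -- Here `r = b c` with `c` a nonunit, so `b x = b c y ∈ 𝔪 b M`; the choice of `x` gives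
            -- `b M = 0`, and `y` itself is the lift.
            · refine ⟨0, ?_⟩
              have := hpure b (by
                rw [hb, mul_comm, mul_smul]
                exact Submodule.smul_mem_smul ((IsLocalRing.mem_maximalIdeal c).2 hc) ⟨y, rfl⟩) y
              rw [zero_smul, sub_zero, mul_comm, mul_smul, this, smul_zero]
        · rintro ⟨a, ha⟩
          exact ⟨r * a, by rw [smul_sub, sub_eq_zero] at ha; rw [ha, mul_smul]⟩
      rw [e]
      refine hC.quotient_sSup (Set.range_nonempty _) (fun I _ J _ => le_total_ideal I J) ?_
      rintro _ ⟨a, rfl⟩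
      exact hM _
    · rw [Finset.coe_image, ← Submodule.map_span, Finset.coe_erase]
      have : Submodule.map (R ∙ x).mkQ (Submodule.span R (S : Set M)) = ⊤ := by
        rw [hspan, Submodule.map_top, Submodule.range_mkQ]
      rw [← this, ← Set.insert_sdiff_self_of_mem (s := (S : Set M)) hx, Submodule.span_insert,
        Submodule.map_sup]
      simp

/-- Transfinite induction on the number of generators: an infinite generating set, ordered by its
initial ordinal, is exhausted by initial segments of smaller cardinality, and `iSup_mem` applies. -/
theorem span_mem (hC : IsLimitClosed C) (hM : ∀ m : M, Ideal.torsionOf R M m ∈ cyclicIdeals C)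
    (κ : Cardinal.{u}) : ∀ S : Set M, Cardinal.mk S = κ →
      C (ModuleCat.of R (Submodule.span R S)) := by
  classical
  induction κ using WellFoundedLT.induction with
  | ind κ ih =>
  intro S hS
  by_cases hfin : S.Finite
  · obtain ⟨T, rfl⟩ := hfin.exists_finset_coe
    let T' : Finset (Submodule.span R (T : Set M)) :=
      T.attach.image fun x => ⟨x.1, Submodule.subset_span x.2⟩
    have hT' : (T' : Set (Submodule.span R (T : Set M))) = Subtype.val ⁻¹' (T : Set M) := by
      ext x
      simp [T', Subtype.ext_iff]
    refine hC.of_finite_span _ _ (fun m => torsionOf_coe m ▸ hM m) T' le_rfl ?_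
    rw [hT', Submodule.span_span_coe_preimage]
  · have hinf : Cardinal.aleph0 ≤ κ := by
      rw [← hS, Cardinal.aleph0_le_mk_iff]
      exact Set.infinite_coe_iff.2 hfin
    have := Cardinal.noMaxOrder hinf
    have : Nonempty κ.ord.ToType := by
      rw [← Cardinal.mk_ne_zero_iff]
      simpa using (Cardinal.aleph0_pos.trans_le hinf).ne'
    have e : κ.ord.ToType ≃ S := Classical.choice (Cardinal.eq.1 (by simp [hS]))
    let N : κ.ord.ToType → Submodule R M := fun j =>
      Submodule.span R ((fun i => (e i : M)) '' Set.Iio j)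
    have hN : Monotone N := fun a b hab =>
      Submodule.span_mono (Set.image_mono (Set.Iio_subset_Iio hab))
    have hsup : Submodule.span R S = ⨆ j, N j := by
      apply le_antisymm
      · refine Submodule.span_le.2 fun x hx => ?_
        obtain ⟨j, hj⟩ := exists_gt (e.symm ⟨x, hx⟩)
        exact Submodule.mem_iSup_of_mem j (Submodule.subset_span ⟨_, hj, by simp⟩)
      · refine iSup_le fun j => Submodule.span_mono ?_
        rintro _ ⟨i, -, rfl⟩
        exact (e i).2
    rw [hsup]
    exact hC.iSup_mem N hN fun j => ih _
      (Cardinal.mk_image_le.trans_lt (by simpa using Cardinal.mk_Iio_lt j)) _ rfl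

theorem mem_iff (hC : IsLimitClosed C) :
    C (ModuleCat.of R M) ↔ ∀ m : M, Ideal.torsionOf R M m ∈ cyclicIdeals C := by
  refine ⟨hC.torsionOf_mem, fun h => ?_⟩
  have := hC.span_mem h _ Set.univ rfl
  rw [Submodule.span_univ] at this
  exact hC.of_injective Submodule.topEquiv.symm.toLinearMap (LinearEquiv.injective _) this

theorem isIdealFamily (hC : IsLimitClosed C) : IsIdealFamily (cyclicIdeals C) where
  top_mem := by
    have : Subsingleton (R ⧸ (⊤ : Ideal R)) := Submodule.Quotient.subsingleton_iff.2 rfl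
    exact hC.of_subsingleton
  residual_mem {I} hI r := by
    refine hC.quotient (I.mkQ ∘ₗ LinearMap.mulRight R r) ?_ hI
    ext x
    simp only [mem_residual, LinearMap.mem_ker, LinearMap.comp_apply, LinearMap.mulRight_apply,
      Submodule.mkQ_apply, Submodule.Quotient.mk_eq_zero]
  sInf_mem {S} hS := by
    refine hC.quotient (LinearMap.pi fun I : S => I.1.mkQ) ?_ (hC.pi (fun I : S => R ⧸ I.1)
      fun I => hS I.2)
    ext x
    simp [funext_iff, Submodule.mem_sInf, Ideal.Quotient.eq_zero_iff_mem]
  sSup_mem {S} hS hne := hC.quotient_sSup hne (fun I _ J _ => le_total_ideal I J) fun I hI => hS hI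
  ext_mem {I J} hI hJI h := by
    -- The module `I ⧸ J` need not be cyclic, so its membership requires the elementwise criterion
    -- `mem_iff`.
    refine hC.extension (Submodule.map J.mkQ I) ?_ ?_
    · refine hC.mem_iff.2 ?_
      rintro ⟨_, a, ha, rfl⟩
      rw [torsionOf_coe]
      convert h a ha
      ext x
      rw [Ideal.mem_torsionOf_iff, ← map_smul, Submodule.mkQ_apply, Submodule.Quotient.mk_eq_zero]
      rfl
    · exact hC.of_injective (Submodule.quotientQuotientEquivQuotient J I hJI).toLinearMap
        (LinearEquiv.injective _) hI

end IsLimitClosed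

end GoodClasses

end Cosilting

namespace Cosilting

/-! ### From classes to systems and back. -/

section SystemsOfClasses

variable {R : Type u} [CommRing R] [IsDomain R] [ValuationRing R]

/-- The annihilators of the elements of `R_q / p` are multiples of `p`. -/
theorem IsLimitClosed.locQuot_iff {C : ObjectProperty (ModuleCat.{u} R)} (hC : IsLimitClosed C)
    {p q : PrimeSpectrum R} (hp : p.asIdeal ∈ cyclicIdeals C) :
    C (locQuot q p) ↔ lowerPrime (cyclicIdeals C) p ≤ q := by
  have key : ∀ (a : R) (s : q.asIdeal.primeCompl) (r : R),
      r ∈ Ideal.torsionOf R (locQuot q p)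
        (Submodule.mkQ _ (IsLocalization.mk' (Localization.AtPrime q.asIdeal) a s)) ↔
      ∃ b ∈ p.asIdeal, r * a = s * b := by
    intro a s r
    have : Ideal.torsionOf R (locQuot q p)
        (Submodule.mkQ _ (IsLocalization.mk' (Localization.AtPrime q.asIdeal) a s)) =
        Ideal.torsionOf R (Localization.AtPrime q.asIdeal ⧸
          Submodule.map (Algebra.linearMap R (Localization.AtPrime q.asIdeal)) p.asIdeal)
          (Submodule.mkQ _ (IsLocalization.mk' (Localization.AtPrime q.asIdeal) a s)) := rfl
    rw [this, Ideal.mem_torsionOf_iff, ← map_smul, Submodule.mkQ_apply, Submodule.Quotient.mk_eq_zero,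
      Submodule.mem_map]
    refine exists_congr fun b => and_congr_right fun _ => ?_
    rw [Algebra.linearMap_apply, IsLocalization.smul_mk',
      eq_comm, IsLocalization.mk'_eq_iff_eq_mul, ← map_mul,
      (IsLocalization.injective (Localization.AtPrime q.asIdeal)
        q.asIdeal.primeCompl_le_nonZeroDivisors).eq_iff, mul_comm b]
  rw [hC.isIdealFamily.lowerPrime_le_iff hp]
  change C (ModuleCat.of R (locQuot q p)) ↔ _
  rw [hC.mem_iff]
  constructor
  · intro h s hs
    convert h (Submodule.mkQ _ (IsLocalization.mk' (Localization.AtPrime q.asIdeal) 1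
      (⟨s, hs⟩ : q.asIdeal.primeCompl)))
    ext r
    rw [key, Ideal.mem_span_singleton_mul]
    simp [eq_comm]
  · intro h m
    obtain ⟨x, rfl⟩ := Submodule.mkQ_surjective _ m
    obtain ⟨a, s, rfl⟩ := IsLocalization.exists_mk'_eq q.asIdeal.primeCompl x
    have : Ideal.torsionOf R (locQuot q p)
        (Submodule.mkQ _ (IsLocalization.mk' (Localization.AtPrime q.asIdeal) a s)) =
        residual (Ideal.span {(s : R)} * p.asIdeal) a := by
      ext r
      rw [key, mem_residual, Ideal.mem_span_singleton_mul]
      simp [eq_comm]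
    rw [this]
    exact hC.isIdealFamily.residual_mem (h s s.2) a

/-- By `locQuot_iff`, both defining conditions become inequalities for lower primes, and the infimum
and supremum are attained. -/
theorem IsLimitClosed.systemOfClass_eq {C : ObjectProperty (ModuleCat.{u} R)}
    (hC : IsLimitClosed C) : systemOfClass C = systemOfFamily (cyclicIdeals C) := by
  have h𝒥 := hC.isIdealFamily
  have e1 : ∀ {p}, p ∈ primeSupport C →
      {q | q ∈ primeSupport C ∧ C (locQuot q p)} =
        {q | q.asIdeal ∈ cyclicIdeals C ∧ lowerPrime (cyclicIdeals C) p ≤ q} := by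
    intro p hp
    ext q
    exact and_congr_right fun _ => hC.locQuot_iff hp
  have e2 : ∀ l : PrimeSpectrum R, {q | q ∈ primeSupport C ∧ C (locQuot l q)} =
      {u | u.asIdeal ∈ cyclicIdeals C ∧ lowerPrime (cyclicIdeals C) u ≤ l} := by
    intro l
    ext q
    exact and_congr_right fun h => hC.locQuot_iff h
  have e3 : ∀ {p}, p ∈ primeSupport C →
      IsLeast {q | q.asIdeal ∈ cyclicIdeals C ∧ lowerPrime (cyclicIdeals C) p ≤ q}
        (lowerPrime (cyclicIdeals C) p) := fun {p} hp =>
    ⟨⟨h𝒥.lowerPrime_mem hp, le_rfl⟩, fun q hq => hq.2⟩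
  ext χ
  constructor
  · rintro ⟨p, hp, h1, h2⟩
    rw [e1 hp] at h1
    rw [e2] at h2
    have hl : χ.lower = lowerPrime (cyclicIdeals C) p := h1.unique (e3 hp).isGLB
    obtain ⟨ξ, hξ, hξl, -⟩ := h𝒥.exists_interval hp
    have hξ1 := hξ.1
    rw [hξl, ← hl] at hξ1
    have : χ = ξ := SpecInterval.ext (hl.trans hξl.symm) (h2.unique hξ1.isLUB)
    exact this ▸ hξ
  · rintro ⟨h1, h2⟩
    refine ⟨χ.upper, h1.1.1, ?_, ?_⟩
    · rw [e1 h1.1.1, ← h2]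
      exact (e3 h1.1.1).isGLB
    · rw [e2]
      exact h1.isLUB

theorem IsLimitClosed.isAdmissible_systemOfClass {C : ObjectProperty (ModuleCat.{u} R)}
    (hC : IsLimitClosed C) : IsAdmissible (systemOfClass C) :=
  hC.systemOfClass_eq ▸ hC.isIdealFamily.isAdmissible

theorem IsLimitClosed.classOfSystem_systemOfClass {C : ObjectProperty (ModuleCat.{u} R)}
    (hC : IsLimitClosed C) : classOfSystem (systemOfClass C) = C := by
  rw [hC.systemOfClass_eq]
  ext M
  change _ ↔ C (ModuleCat.of R M)
  rw [hC.mem_iff]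
  refine forall_congr' fun m => ?_
  by_cases hm : m = 0
  · subst hm
    simp [hC.isIdealFamily.top_mem]
  · rw [← Ideal.torsionOf_eq_top_iff (R := R)] at hm
    rw [hC.isIdealFamily.mem_iff hm, Ne, ← Ideal.torsionOf_eq_top_iff (R := R)]
    exact ⟨fun h => h hm, fun h _ => h⟩

/-- The ideal `I` is the annihilator of `1`, and the annihilators of the other nonzero elements are
residuals of `I`, which stay in the same `⟨χ⟩`. -/
theorem cyclicIdeals_classOfSystem (X : Set (SpecInterval R)) :
    cyclicIdeals (classOfSystem X) = idealsOfSystem X := by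
  have h1 : ∀ I : Ideal R, Ideal.torsionOf R (R ⧸ I) 1 = I := by
    intro I
    ext r
    rw [Ideal.mem_torsionOf_iff, ← Ideal.Quotient.eq_zero_iff_mem, Algebra.smul_def, mul_one]
    rfl
  ext I
  constructor
  · intro h hI
    have h10 : (1 : R ⧸ I) ≠ 0 := by
      rwa [Ne, ← Ideal.torsionOf_eq_top_iff (R := R), h1]
    obtain ⟨χ, hχ, h⟩ := h (1 : R ⧸ I) h10
    exact ⟨χ, hχ, h1 I ▸ h⟩
  · intro h m hm
    obtain ⟨a, rfl⟩ := Ideal.Quotient.mk_surjective m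
    have ha : a ∉ I := fun h => hm (Ideal.Quotient.eq_zero_iff_mem.2 h)
    have e : Ideal.torsionOf R (R ⧸ I) (Ideal.Quotient.mk I a) = residual I a := by
      ext r
      rw [Ideal.mem_torsionOf_iff, mem_residual, ← Ideal.Quotient.eq_zero_iff_mem, map_mul,
        Algebra.smul_def]
      rfl
    obtain ⟨χ, hχ, h⟩ := h fun h => ha (h ▸ Submodule.mem_top)
    obtain ⟨h2, h3, h4⟩ := SpecInterval.mem_ideals.1 h
    refine ⟨χ, hχ, ?_⟩
    change Ideal.torsionOf R (R ⧸ I) (Ideal.Quotient.mk I a) ∈ χ.ideals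
    rw [e]
    refine SpecInterval.mem_ideals.2 ⟨fun h => ha ?_, fun x hx => ?_, h4.residual a⟩
    · have : (1 : R) ∈ residual I a := h ▸ Submodule.mem_top
      simpa using this
    · exact Ideal.mul_mem_right a I (h3 hx)

theorem IsAdmissible.systemOfClass_classOfSystem {X : Set (SpecInterval R)} (hX : IsAdmissible X)
    (hC : IsLimitClosed (classOfSystem X)) : systemOfClass (classOfSystem X) = X := by
  have h𝒥 := hC.isIdealFamily
  rw [hC.systemOfClass_eq]
  rw [cyclicIdeals_classOfSystem X] at h𝒥 ⊢
  exact hX.systemOfFamily_eq h𝒥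

end SystemsOfClasses

end Cosilting

namespace Cosilting

/-! ### Cosilting classes are limit closed: a counting argument on trees. -/

section ReducedProducts

open Cardinal in
-- The level sets are chosen so large that each encodes all subsets of the data available below it;
-- this makes the branches as numerous as the subsets of `Γ` in `exists_lift_vanishing`.
theorem exists_tree {ι : Type u} [LinearOrder ι] [WellFoundedLT ι] (c : ι → Type u) :
    ∃ X : ι → Type u, ∀ i, Nonempty (X i ≃ Set (c i × (∀ j : Set.Iio i, X j))) := by
  let x : ι → Cardinal.{u} := WellFoundedLT.fix fun i x =>
    2 ^ (#(c i) * Cardinal.prod fun j : Set.Iio i => x j.1 j.2)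
  have hx : ∀ i, x i = 2 ^ (#(c i) * Cardinal.prod fun j : Set.Iio i => x j.1) := fun i =>
    WellFoundedLT.fix_eq _ i
  refine ⟨fun i => (x i).out, fun i => Cardinal.eq.1 ?_⟩
  rw [Cardinal.mk_out, hx, Cardinal.mk_set, Cardinal.mk_prod, Cardinal.mk_pi]
  simp

variable {R : Type u} [CommRing R]

/-- Lifting along `σ` descends from products to reduced products modulo the filter of final segments:
otherwise one would obtain too many homomorphisms on a tree-indexed product. -/
theorem exists_lift_vanishing {ι : Type u} [LinearOrder ι] [WellFoundedLT ι] [NoMaxOrder ι]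
    [Nonempty ι] (P : ι → Type u) [∀ i, AddCommGroup (P i)] [∀ i, Module R (P i)]
    {Q₀ Q₁ : Type u} [AddCommGroup Q₀] [Module R Q₀] [AddCommGroup Q₁] [Module R Q₁]
    (σ : Q₀ →ₗ[R] Q₁)
    (hσ : ∀ (Λ : Type u) (k : Λ → ι) (A : Submodule R (∀ l, P (k l))) (f : A →ₗ[R] Q₁),
      ∃ g : A →ₗ[R] Q₀, σ ∘ₗ g = f)
    (f : (∀ j, P j) →ₗ[R] Q₁) (hf : ∀ x, (∃ j, ∀ i, j ≤ i → x i = 0) → f x = 0) :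
    ∃ g : (∀ j, P j) →ₗ[R] Q₀, σ ∘ₗ g = f ∧ ∀ x, (∃ j, ∀ i, j ≤ i → x i = 0) → g x = 0 := by
  classical
  by_contra hcon
  obtain ⟨X, hX⟩ := exists_tree fun i : ι => Q₀ × (∀ j : Set.Iio i, P j)
  let eX := fun i => (hX i).some
  have hne : ∀ i, Nonempty (X i) := fun i => ⟨(eX i).symm ∅⟩
  let Γ : Type u := Σ i : ι, (Q₀ × (∀ j : Set.Iio i, P j)) × (∀ j : Set.Iio i, X j)
  -- A subset of `Γ` is a family of subsets, one for each level, hence a branch of the tree.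
  let eB : Set Γ ≃ (∀ i, X i) :=
    (Equiv.piCurry fun (_ : ι) _ => Prop).trans (Equiv.piCongrRight fun i => (eX i).symm)
  let res : (∀ i, X i) → ∀ i : ι, ∀ j : Set.Iio i, X j := fun b i j => b j
  let Λ : Type u := Σ i : ι, ∀ j : Set.Iio i, X j
  -- The map `e b` spreads a family along the nodes of the branch `b`.
  let e : (∀ i, X i) → (∀ j, P j) →ₗ[R] ∀ l : Λ, P l.1 := fun b =>
    LinearMap.pi fun l => if l.2 = res b l.1 then LinearMap.proj l.1 else 0
  let E : ((∀ i, X i) →₀ (∀ j, P j)) →ₗ[R] ∀ l : Λ, P l.1 := Finsupp.lsum R e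
  have he : ∀ b x l, e b x l = if l.2 = res b l.1 then x l.1 else 0 := by
    intro b x l
    simp only [e, LinearMap.pi_apply]
    split_ifs <;> rfl
  -- Finitely many distinct branches are separated from some level on, so cancellation in `E` can
  -- only occur below it.
  have hker : ∀ x, E x = 0 → ∀ b, ∃ j, ∀ i, j ≤ i → x b i = 0 := by
    intro x hx b
    have hsep : ∀ b', ∃ j, b' ≠ b → ∀ i, j ≤ i → res b i ≠ res b' i := by
      intro b'
      by_cases hb : b' = b
      · exact ⟨Classical.arbitrary ι, fun h => absurd hb h⟩
      obtain ⟨j, hj⟩ := Function.ne_iff.1 hb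
      obtain ⟨j', hj'⟩ := exists_gt j
      exact ⟨j', fun _ i hi h => hj (congrFun h ⟨j, hj'.trans_le hi⟩).symm⟩
    choose J hJ using hsep
    obtain ⟨m, hm⟩ := Finset.exists_le (insert (J b) (x.support.image J))
    refine ⟨m, fun i hi => ?_⟩
    have h1 := congrFun hx ⟨i, res b i⟩
    have h2 : E x ⟨i, res b i⟩ = x b i := by
      simp only [E, Finsupp.lsum_apply, Finsupp.sum, Finset.sum_apply]
      rw [Finset.sum_eq_single b]
      · simp [he]
      · intro b' hb' hne
        rw [he, if_neg]
        exact hJ b' hne i ((hm _ (Finset.mem_insert_of_mem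
          (Finset.mem_image_of_mem J hb'))).trans hi)
      · intro hb
        rw [Finsupp.notMem_support_iff.1 hb]
        simp
    rw [← h2, h1]
    rfl
  -- Each set `S` of branches gives a map that is `f` on the branches in `S` and `0` elsewhere. It
  -- kills `ker E`, so it factors through the range of `E` and lifts along `σ`.
  let F : Set (∀ i, X i) → ((∀ i, X i) →₀ (∀ j, P j)) →ₗ[R] Q₁ := fun S =>
    Finsupp.lsum R fun b => if b ∈ S then f else 0
  have hF : ∀ S b x, F S (Finsupp.single b x) = if b ∈ S then f x else 0 := by
    intro S b x
    simp only [F, Finsupp.lsum_single]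
    split_ifs <;> rfl
  have hlift : ∀ S, ∃ H : ((∀ i, X i) →₀ (∀ j, P j)) →ₗ[R] Q₀,
      σ ∘ₗ H = F S ∧ ∀ x, E x = 0 → H x = 0 := by
    intro S
    have hle : LinearMap.ker E ≤ LinearMap.ker (F S) := by
      intro x hx
      rw [LinearMap.mem_ker]
      simp only [F, Finsupp.lsum_apply, Finsupp.sum]
      refine Finset.sum_eq_zero fun b _ => ?_
      split_ifs
      · exact hf _ (hker x hx b)
      · rfl
    obtain ⟨g, hg⟩ := hσ Λ Sigma.fst (LinearMap.range E)
      ((LinearMap.ker E).liftQ (F S) hle ∘ₗ E.quotKerEquivRange.symm.toLinearMap)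
    refine ⟨g ∘ₗ E.rangeRestrict, ?_, fun x hx => ?_⟩
    · rw [← LinearMap.comp_assoc, hg]
      ext1 b
      ext1 x
      have : E.rangeRestrict (Finsupp.single b x) =
        E.quotKerEquivRange (Submodule.Quotient.mk (Finsupp.single b x)) := rfl
      simp only [LinearMap.comp_apply, Finsupp.lsingle_apply, LinearEquiv.coe_coe, this,
        LinearEquiv.symm_apply_apply, Submodule.liftQ_apply]
    · have : E.rangeRestrict x = 0 := Subtype.ext hx
      rw [LinearMap.comp_apply, this, map_zero]
  choose H hH hH0 using hlift
  let extX : ∀ i : ι, (∀ j : Set.Iio i, X j) → ∀ j, X j := fun i n j =>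
    if h : j < i then n ⟨j, h⟩ else (hne j).some
  let extP : ∀ i : ι, (∀ j : Set.Iio i, P j) → ∀ j, P j := fun i n j =>
    if h : j < i then n ⟨j, h⟩ else 0
  -- The code of `S` records the values of `H S` on eventually vanishing families; modulo `ker E`
  -- such a family involves only an initial part of its branch.
  let Φ : Set (∀ i, X i) → Set Γ := fun S =>
    {γ | H S (Finsupp.single (extX γ.1 γ.2.2) (extP γ.1 γ.2.1.2)) = γ.2.1.1}
  have hΦ : ∀ S i v n, H S (Finsupp.single (extX i n) (extP i v)) ∈
      {q | (⟨i, (q, v), n⟩ : Γ) ∈ Φ S} := fun S i v n => rfl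
  have hinj : Function.Injective Φ := by
    have key : ∀ S S', Φ S = Φ S' → ∀ b ∈ S, b ∈ S' := by
      intro S S' hSS b hb
      by_contra hb'
      -- If `S` and `S'` have the same code and differ at `b`, the difference of their lifts along
      -- `b` is a lift of `f` that vanishes on eventually vanishing families.
      refine hcon ⟨(H S - H S') ∘ₗ Finsupp.lsingle b, ?_, ?_⟩
      · ext1 x
        have h1 := LinearMap.congr_fun (hH S) (Finsupp.single b x)
        have h2 := LinearMap.congr_fun (hH S') (Finsupp.single b x)
        rw [hF, if_pos hb] at h1
        rw [hF, if_neg hb'] at h2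
        simp only [LinearMap.comp_apply, Finsupp.lsingle_apply, LinearMap.sub_apply, map_sub] at *
        rw [h1, h2, sub_zero]
      · rintro x ⟨j, hj⟩
        have hx : extP j (fun i => x i) = x := by
          ext i
          by_cases h : i < j
          · simp [extP, h]
          · simp [extP, h, hj i (not_lt.1 h)]
        have hE : E (Finsupp.single b x - Finsupp.single (extX j (res b j)) x) = 0 := by
          ext l
          rw [map_sub]
          simp only [E, Finsupp.lsum_single, Pi.sub_apply, Pi.zero_apply, he]
          by_cases h : l.1 < j
          · have : res b l.1 = res (extX j (res b j)) l.1 := by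
              ext i
              have hi : (i : ι) < j := lt_trans i.2 h
              simp [res, extX, hi]
            rw [this, sub_self]
          · simp [hj l.1 (not_lt.1 h)]
        have e1 : ∀ S, H S (Finsupp.single b x) =
            H S (Finsupp.single (extX j (res b j)) (extP j fun i => x i)) := by
          intro S
          rw [hx, ← sub_eq_zero, ← map_sub]
          exact hH0 S _ hE
        have h2 := hΦ S j (fun i => x i) (res b j)
        rw [hSS] at h2
        have h3 : H S' (Finsupp.single (extX j (res b j)) (extP j fun i => x i)) =
          H S (Finsupp.single (extX j (res b j)) (extP j fun i => x i)) := h2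
        simp only [LinearMap.comp_apply, Finsupp.lsingle_apply, LinearMap.sub_apply]
        rw [e1 S, e1 S', h3, sub_self]
    exact fun S S' h => Set.Subset.antisymm (key S S' h) (key S' S h.symm)
  exact Function.cantor_injective (eB ∘ Φ) (eB.injective.comp hinj)

theorem cogen_of_injective {T : ModuleCat.{u} R} {M N : Type u} [AddCommGroup M] [Module R M]
    [AddCommGroup N] [Module R N] (f : M →ₗ[R] N) (hf : Function.Injective f)
    (h : cogen T (ModuleCat.of R N)) : cogen T (ModuleCat.of R M) := by
  obtain ⟨I, g, hg⟩ := h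
  exact ⟨I, g ∘ₗ f, hg.comp hf⟩

theorem cogen_pi {T : ModuleCat.{u} R} {I : Type u} (M : I → Type u) [∀ i, AddCommGroup (M i)]
    [∀ i, Module R (M i)] (h : ∀ i, cogen T (ModuleCat.of R (M i))) :
    cogen T (ModuleCat.of R (∀ i, M i)) := by
  choose J g hg using h
  refine ⟨Σ i, J i, LinearMap.pi fun x => LinearMap.proj x.2 ∘ₗ g x.1 ∘ₗ LinearMap.proj x.1, ?_⟩
  intro x y hxy
  funext i
  refine hg i (funext fun j => ?_)
  exact congrFun hxy ⟨i, j⟩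

/-- Injectivity of `Q₀` extends a lift from `N` to `M`; the remaining error factors through `M ⧸ N`
and is lifted there. -/
theorem homSurjClass_extension {Q₀ Q₁ : ModuleCat.{u} R} (hQ : Module.Injective R Q₀)
    (σ : Q₀ →ₗ[R] Q₁) {M : Type u} [AddCommGroup M] [Module R M] (N : Submodule R M)
    (h1 : homSurjClass σ (ModuleCat.of R N)) (h2 : homSurjClass σ (ModuleCat.of R (M ⧸ N))) :
    homSurjClass σ (ModuleCat.of R M) := by
  intro f
  change M →ₗ[R] Q₁ at f
  obtain ⟨g, hg⟩ := h1 (f ∘ₗ N.subtype)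
  change N →ₗ[R] Q₀ at g
  obtain ⟨g', hg'⟩ := hQ.out N.subtype N.injective_subtype g
  obtain ⟨k, hk⟩ := h2 (N.liftQ (f - σ ∘ₗ g') (fun x hx => by
    have h3 := hg' ⟨x, hx⟩
    have h4 := LinearMap.congr_fun hg ⟨x, hx⟩
    simp only [LinearMap.comp_apply, Submodule.subtype_apply] at h3 h4
    rw [LinearMap.mem_ker, LinearMap.sub_apply, LinearMap.comp_apply, h3, ← h4]
    exact sub_self _))
  change (M ⧸ N) →ₗ[R] Q₀ at k
  refine ⟨g' + k ∘ₗ N.mkQ, ?_⟩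
  ext x
  have h5 := LinearMap.congr_fun hk (N.mkQ x)
  change σ (g' x + k (N.mkQ x)) = f x
  change σ (k (N.mkQ x)) = f x - σ (g' x) at h5
  rw [map_add, h5, add_sub_cancel]

theorem IsCosiltingModule.isLimitClosed {T : ModuleCat.{u} R} (hT : IsCosiltingModule T) :
    IsLimitClosed (cogen T) := by
  obtain ⟨Q₀, Q₁, i, σ, hQ₀, -, -, -, hσ⟩ := hT
  refine ⟨cogen_of_injective, cogen_pi, fun N h1 h2 => ?_, ?_⟩
  · rw [← hσ] at h1 h2 ⊢
    exact homSurjClass_extension hQ₀ σ N h1 h2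
  · intro M _ _ ι _ _ _ _ N hN h
    have hmem : ∀ x, x ∈ ⨆ j, N j ↔ ∃ j, x ∈ N j := fun x =>
      Submodule.mem_iSup_of_directed _ hN.directed_le
    let K : Submodule R (∀ j, M ⧸ N j) :=
      { carrier := {x | ∃ j, ∀ i, j ≤ i → x i = 0}
        zero_mem' := ⟨Classical.arbitrary ι, fun _ _ => rfl⟩
        add_mem' := by
          rintro x y ⟨a, ha⟩ ⟨b, hb⟩
          refine ⟨max a b, fun i hi => ?_⟩
          rw [Pi.add_apply, ha i ((le_max_left _ _).trans hi), hb i ((le_max_right _ _).trans hi),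
            add_zero]
        smul_mem' := by
          rintro r x ⟨a, ha⟩
          exact ⟨a, fun i hi => by rw [Pi.smul_apply, ha i hi, smul_zero]⟩ }
    have hred : cogen T (ModuleCat.of R ((∀ j, M ⧸ N j) ⧸ K)) := by
      rw [← hσ]
      intro f
      change ((∀ j, M ⧸ N j) ⧸ K) →ₗ[R] Q₁ at f
      obtain ⟨g, hg, hgK⟩ := exists_lift_vanishing (fun j => M ⧸ N j) σ (fun Λ k A f => by
        have hA : homSurjClass σ (ModuleCat.of R A) := by
          rw [hσ]
          exact cogen_of_injective A.subtype A.injective_subtype (cogen_pi _ fun l => h (k l))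
        exact hA f) (f ∘ₗ K.mkQ) (fun x hx => by
          rw [LinearMap.comp_apply, Submodule.mkQ_apply, (Submodule.Quotient.mk_eq_zero K).2 hx,
            map_zero])
      refine ⟨K.liftQ g fun x hx => hgK x hx, ?_⟩
      refine Submodule.linearMap_qext _ ?_
      rw [← hg]
      rfl
    refine cogen_of_injective ((⨆ j, N j).liftQ (K.mkQ ∘ₗ LinearMap.pi fun j => (N j).mkQ) ?_) ?_ hred
    · intro x hx
      obtain ⟨j, hj⟩ := (hmem x).1 hx
      rw [LinearMap.mem_ker, LinearMap.comp_apply, Submodule.mkQ_apply, Submodule.Quotient.mk_eq_zero]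
      exact ⟨j, fun i hi => (Submodule.Quotient.mk_eq_zero _).2 (hN hi hj)⟩
    · refine LinearMap.ker_eq_bot.1 (Submodule.ker_liftQ_eq_bot _ _ _ fun x hx => ?_)
      rw [LinearMap.mem_ker, LinearMap.comp_apply, Submodule.mkQ_apply,
        Submodule.Quotient.mk_eq_zero] at hx
      obtain ⟨j, hj⟩ := hx
      exact (hmem x).2 ⟨j, (Submodule.Quotient.mk_eq_zero _).1 (hj j le_rfl)⟩

end ReducedProducts

end Cosilting

namespace Cosilting

/-! ### Lifting along dual maps as injectivity after tensoring. -/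

section TensorCriterion

open TensorProduct

variable {R : Type u} [CommRing R]

/-- The canonical map from an ideal to a localization. -/
noncomputable def idealToLoc (J : Ideal R) (S : Submonoid R) : J →ₗ[R] Localization S :=
  Algebra.linearMap R (Localization S) ∘ₗ J.subtype

theorem idealToLoc_apply (J : Ideal R) (S : Submonoid R) (a : J) :
    idealToLoc J S a = algebraMap R (Localization S) a := rfl

/-- By tensor-hom adjunction, composition with the dual of `g` is the character dual of `M ⊗ A → M ⊗
B`. -/
theorem dual_comp_surjective_iff {A B M : Type u} [AddCommGroup A] [Module R A] [AddCommGroup B]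
    [Module R B] [AddCommGroup M] [Module R M] (g : A →ₗ[R] B) :
    (∀ f : M →ₗ[R] CharacterModule A, ∃ h : M →ₗ[R] CharacterModule B,
      CharacterModule.dual g ∘ₗ h = f) ↔ Function.Injective (g.lTensor M) := by
  rw [← CharacterModule.dual_surjective_iff_injective]
  have key : ∀ c : CharacterModule (M ⊗[R] B), CharacterModule.dual g ∘ₗ CharacterModule.curry c =
      CharacterModule.curry (CharacterModule.dual (g.lTensor M) c) := fun c => rfl
  constructor
  · intro h c
    obtain ⟨k, hk⟩ := h (CharacterModule.curry c)
    refine ⟨CharacterModule.homEquiv k, ?_⟩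
    apply CharacterModule.homEquiv.symm.injective
    change CharacterModule.curry _ = CharacterModule.curry _
    rw [← key, ← hk]
    congr 1
  · intro h f
    obtain ⟨c, hc⟩ := h (CharacterModule.homEquiv f)
    refine ⟨CharacterModule.curry c, ?_⟩
    rw [key, hc]
    exact CharacterModule.homEquiv.symm_apply_apply f

theorem tmul_loc_eq_zero_iff {M : Type u} [AddCommGroup M] [Module R M] (S : Submonoid R) (m : M) :
    m ⊗ₜ[R] (1 : Localization S) = 0 ↔ ∃ s ∈ S, s • m = 0 := by
  rw [← (TensorProduct.comm R M (Localization S)).map_eq_zero_iff, TensorProduct.comm_tmul]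
  change TensorProduct.mk R (Localization S) M 1 m = 0 ↔ _
  rw [IsLocalizedModule.eq_zero_iff S]
  exact ⟨fun ⟨s, hs⟩ => ⟨s, s.2, hs⟩, fun ⟨s, hs, h⟩ => ⟨⟨s, hs⟩, h⟩⟩

variable [IsDomain R] [ValuationRing R]

theorem flat_ideal (J : Ideal R) : Module.Flat R J := by
  rw [Module.Flat.flat_iff_torsion_eq_bot_of_isBezout, ← Submodule.isTorsionFree_iff_torsion_eq_bot]
  infer_instance

theorem exists_tmul {M : Type u} [AddCommGroup M] [Module R M] (J : Ideal R) (t : M ⊗[R] J) :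
    ∃ (m : M) (a : J), t = m ⊗ₜ a := by
  induction t using TensorProduct.induction_on with
  | zero => exact ⟨0, 0, by simp⟩
  | tmul m a => exact ⟨m, a, rfl⟩
  | add x y hx hy =>
    obtain ⟨m, a, rfl⟩ := hx
    obtain ⟨n, b, rfl⟩ := hy
    rcases ValuationRing.dvd_total (a : R) b with ⟨c, hc⟩ | ⟨c, hc⟩
    · have : b = c • a := Subtype.ext (by simp [hc, mul_comm])
      exact ⟨m + c • n, a, by rw [this, ← TensorProduct.smul_tmul, TensorProduct.add_tmul]⟩
    · have : a = c • b := Subtype.ext (by simp [hc, mul_comm])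
      exact ⟨c • m + n, b, by rw [this, ← TensorProduct.smul_tmul, TensorProduct.add_tmul]⟩

theorem exists_dvd_of_sum {J : Ideal R} {n : ℕ} (y : Fin n → J) :
    ∃ b ∈ J, ∀ i, b ∣ (y i : R) := by
  obtain ⟨b, hb⟩ := (IsBezout.isPrincipal_of_FG (Ideal.span (Set.range fun i => (y i : R)))
    (Submodule.fg_span (Set.finite_range _))).principal
  refine ⟨b, ?_, fun i => ?_⟩
  · have : b ∈ Ideal.span (Set.range fun i => (y i : R)) := by
      rw [hb]
      exact Submodule.mem_span_singleton_self b
    refine (Ideal.span_le.2 ?_) this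
    rintro _ ⟨i, rfl⟩
    exact (y i).2
  · have : (y i : R) ∈ Ideal.span (Set.range fun i => (y i : R)) := Ideal.subset_span ⟨i, rfl⟩
    rw [hb] at this
    exact Ideal.mem_span_singleton.1 this

/-- Flatness of `J` makes a vanishing tensor vanish trivially; the finitely many elements of `J`
involved are multiples of one `b ∈ J`. -/
theorem tmul_ideal_eq_zero {M : Type u} [AddCommGroup M] [Module R M] {J : Ideal R} {m : M} {a : J} :
    m ⊗ₜ[R] a = 0 ↔ ∃ b ∈ J, ∃ c : R, (a : R) = b * c ∧ c • m = 0 := by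
  constructor
  · intro h
    have := flat_ideal J
    obtain ⟨k, c, y, h1, h2⟩ := TensorProduct.vanishesTrivially_of_sum_tmul_eq_zero_of_rTensor_injective
      R (m := fun _ : Unit => m) (n := fun _ : Unit => a)
      (Module.Flat.rTensor_preserves_injective_linearMap _ (Submodule.injective_subtype _))
      (by simpa using h)
    obtain ⟨b, hb, hby⟩ := exists_dvd_of_sum y
    choose d hd using hby
    refine ⟨b, hb, ∑ j, d j * c () j, ?_, ?_⟩
    · have h1' : a = ∑ j, c () j • y j := h1 ()
      rw [h1', Finset.mul_sum]
      simp only [AddSubmonoidClass.coe_finsetSum, Submodule.coe_smul, smul_eq_mul]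
      exact Finset.sum_congr rfl fun j _ => by rw [hd j]; ring
    · rw [Finset.sum_smul]
      refine Finset.sum_eq_zero fun j _ => ?_
      have h2' : c () j • m = 0 := by simpa using h2 j
      rw [mul_smul, h2', smul_zero]
  · rintro ⟨b, hb, c, h1, h2⟩
    have : a = c • (⟨b, hb⟩ : J) := Subtype.ext (by simp [h1, mul_comm])
    rw [this, ← TensorProduct.smul_tmul, h2, TensorProduct.zero_tmul]

theorem lTensor_idealToLoc_injective_iff {M : Type u} [AddCommGroup M] [Module R M] (J : Ideal R)
    (S : Submonoid R) : Function.Injective ((idealToLoc J S).lTensor M) ↔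
      ∀ m : M, ∀ a ∈ J, (∃ s ∈ S, s • a • m = 0) →
        ∃ b ∈ J, ∃ c : R, a = b * c ∧ c • m = 0 := by
  have key : ∀ (m : M) (a : J), (idealToLoc J S).lTensor M (m ⊗ₜ a) = 0 ↔
      ∃ s ∈ S, s • (a : R) • m = 0 := by
    intro m a
    rw [← tmul_loc_eq_zero_iff, LinearMap.lTensor_tmul, idealToLoc_apply,
      Algebra.algebraMap_eq_smul_one, TensorProduct.smul_tmul]
  rw [injective_iff_map_eq_zero]
  constructor
  · intro h m a ha hs
    exact tmul_ideal_eq_zero (a := ⟨a, ha⟩).1 (h _ ((key m ⟨a, ha⟩).2 hs))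
  · intro h t ht
    obtain ⟨m, a, rfl⟩ := exists_tmul J t
    exact tmul_ideal_eq_zero.2 (h m a a.2 ((key m a).1 ht))

end TensorCriterion

/-! ### Test pairs characterize `C_X`. -/

section TestPairs

variable {R : Type u} [CommRing R]

/-- The pairs `(J, S)` whose canonical maps `J → S⁻¹R` are used to test membership in `C_X`. -/
structure IsTestPair (X : Set (SpecInterval R)) (J : Ideal R) (S : Submonoid R) : Prop where
  idempotent : J = J * J
  cut : ∀ η ∈ X, J ≤ η.lower.asIdeal ∨ (¬ J ≤ η.upper.asIdeal ∧ ∀ s ∈ S, s ∉ η.upper.asIdeal)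
  eq : S = ⊤ ∨ ∃ χ ∈ X, χ.lower.asIdeal ≤ J ∧ S = χ.upper.asIdeal.primeCompl

/-- The elementwise form of the injectivity of `M ⊗ J → M ⊗ S⁻¹R` for all test pairs. -/
def PassesTests (X : Set (SpecInterval R)) (M : Type u) [AddCommGroup M] [Module R M] : Prop :=
  ∀ J S, IsTestPair X J S → ∀ m : M, ∀ a ∈ J, (∃ s ∈ S, s • a • m = 0) →
    ∃ b ∈ J, ∃ c : R, a = b * c ∧ c • m = 0

theorem IsAdmissible.lower_mul_self {X : Set (SpecInterval R)} (hX : IsAdmissible X) {χ : SpecInterval R} (hχ : χ ∈ X) :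
    χ.lower.asIdeal = χ.lower.asIdeal * χ.lower.asIdeal := by
  rw [← pow_two]
  exact hX.idempotent χ hχ

variable [IsDomain R] [ValuationRing R] {X : Set (SpecInterval R)}

theorem exists_mul_of_mem_mul {I J : Ideal R} {x : R} (hx : x ∈ I * J) :
    ∃ a ∈ I, ∃ b ∈ J, x = a * b := by
  induction hx using Submodule.mul_induction_on' with
  | mem_mul_mem a ha b hb => exact ⟨a, ha, b, hb, rfl⟩
  | add x _ y _ hx hy =>
    obtain ⟨a, ha, b, hb, rfl⟩ := hx
    obtain ⟨c, hc, d, hd, rfl⟩ := hy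
    rcases ValuationRing.dvd_total a c with ⟨e, rfl⟩ | ⟨e, rfl⟩
    · exact ⟨a, ha, b + e * d, J.add_mem hb (J.mul_mem_left _ hd), by ring⟩
    · exact ⟨c, hc, e * b + d, J.add_mem (J.mul_mem_left _ hb) hd, by ring⟩

theorem le_of_notMem_prime {I : Ideal R} {P : PrimeSpectrum R} {x : R} (hx : x ∈ I)
    (hP : x ∉ P.asIdeal) : P.asIdeal ≤ I := by
  intro y hy
  rcases ValuationRing.dvd_total x y with ⟨c, rfl⟩ | ⟨c, rfl⟩
  · exact Ideal.mul_mem_right c I hx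
  · exact absurd (Ideal.mul_mem_right c _ hy) hP

/-- If `J` is below the interval of `Ann m`, idempotency factors `a` inside `J`. Otherwise
saturation gives `a ∈ Ann m`, and any `t ∈ J` outside the upper end can be split off from `a`. -/
theorem passesTests {M : ModuleCat.{u} R} (hM : classOfSystem X M) :
    PassesTests X M := by
  rintro J S hJS m a ha ⟨s, hs, hsam⟩
  by_cases hm : m = 0
  · exact ⟨a, ha, 1, by simp, by simp [hm]⟩
  obtain ⟨η, hη, hI⟩ := hM m hm
  obtain ⟨hIt, h1, h2⟩ := SpecInterval.mem_ideals.1 hI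
  rcases hJS.cut η hη with h | ⟨h, hS⟩
  · rw [hJS.idempotent] at ha
    obtain ⟨b, hb, c, hc, rfl⟩ := exists_mul_of_mem_mul ha
    exact ⟨b, hb, c, rfl, (Ideal.mem_torsionOf_iff m c).1 (h1 (h hc))⟩
  · have haI : a ∈ Ideal.torsionOf R M m :=
      h2 s (hS s hs) a ((Ideal.mem_torsionOf_iff m _).2 (by rwa [mul_smul]))
    obtain ⟨t, ht, htη⟩ := SetLike.not_le_iff_exists.1 h
    rcases ValuationRing.dvd_total t a with ⟨c, rfl⟩ | ⟨c, rfl⟩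
    · exact ⟨t, ht, c, rfl, (Ideal.mem_torsionOf_iff m c).1 (h2 t htη c haI)⟩
    · exact absurd (h2.le hIt (Ideal.mul_mem_right c _ haI)) htη

namespace IsAdmissible

theorem upper_le_or (hX : IsAdmissible X) {η μ : SpecInterval R} (hη : η ∈ X) (hμ : μ ∈ X) :
    η.upper ≤ μ.upper ∨ μ.upper < η.lower := by
  by_cases h : η = μ
  · exact Or.inl (h ▸ le_rfl)
  rcases primes_le_total η.lower μ.lower with h1 | h1
  · exact Or.inl ((hX.disjoint η hη μ hμ h h1).le.trans μ.lower_le_upper)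
  · exact Or.inr (hX.disjoint μ hμ η hη (Ne.symm h) h1)

theorem lower_le_or (hX : IsAdmissible X) {η χ : SpecInterval R} (hη : η ∈ X) (hχ : χ ∈ X) :
    χ.lower ≤ η.lower ∨ η.upper < χ.lower := by
  by_cases h : η = χ
  · exact Or.inl (h ▸ le_rfl)
  rcases primes_le_total η.lower χ.lower with h1 | h1
  · exact Or.inr (hX.disjoint η hη χ hχ h h1)
  · exact Or.inl h1

theorem isTestPair_interval (hX : IsAdmissible X) {χ : SpecInterval R} (hχ : χ ∈ X) :
    IsTestPair X χ.lower.asIdeal χ.upper.asIdeal.primeCompl where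
  idempotent := hX.lower_mul_self hχ
  cut η hη := by
    refine (hX.lower_le_or hη hχ).imp id fun h => ⟨fun h' => h.not_ge h', fun s hs hs' => hs ?_⟩
    exact χ.lower_le_upper (h.le hs')
  eq := Or.inr ⟨χ, hχ, le_rfl, rfl⟩

theorem exists_maximal_lower (hX : IsAdmissible X) {M : Type u} [AddCommGroup M] [Module R M]
    (hM : PassesTests X M) {m : M} (hm : m ≠ 0) :
    ∃ μ ∈ X, μ.lower.asIdeal ≤ Ideal.torsionOf R M m ∧
      ∀ χ ∈ X, χ.lower.asIdeal ≤ Ideal.torsionOf R M m → χ.lower ≤ μ.lower := by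
  have hne : X.Nonempty := by
    by_contra hX0
    rw [Set.not_nonempty_iff_eq_empty] at hX0
    -- For empty `X` the pair `(R, R)` is a test pair with zero localization, forcing `M = 0`.
    have hpair : IsTestPair X ⊤ ⊤ :=
      ⟨by simp, fun η hη => by simp [hX0] at hη, Or.inl rfl⟩
    obtain ⟨b, -, c, hbc, hc⟩ := hM _ _ hpair m 1 Submodule.mem_top ⟨0, trivial, by simp⟩
    exact hm (by rw [← one_smul R m, hbc, mul_smul, hc, smul_zero])
  let Y : Set (SpecInterval R) := {χ ∈ X | χ.lower.asIdeal ≤ Ideal.torsionOf R M m}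
  have hYne : Y.Nonempty := by
    obtain ⟨ν, hν, e⟩ := (hX.complete X subset_rfl hne).2
    have hmin : ∀ η ∈ X, ν.upper ≤ η.upper := fun η hη x hx =>
      Set.mem_iInter₂.1 (e ▸ hx : x ∈ ⋂ χ ∈ X, (χ.upper.asIdeal : Set R)) η hη
    -- The least interval `ν` gives a pair with zero localization, which says that `ν.lower`
    -- annihilates `M`.
    have hpair : IsTestPair X ν.lower.asIdeal ⊤ := by
      refine ⟨hX.lower_mul_self hν, fun η hη => Or.inl ?_, Or.inl rfl⟩
      refine (hX.lower_le_or hη hν).resolve_right fun h => ?_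
      exact ((hmin η hη).trans_lt h).not_ge ν.lower_le_upper
    refine ⟨ν, hν, fun a ha => ?_⟩
    obtain ⟨b, -, c, rfl, hc⟩ := hM _ _ hpair m a ha ⟨0, trivial, by simp⟩
    exact Ideal.mul_mem_left _ b hc
  obtain ⟨μ, hμ, e⟩ := (hX.complete Y (Set.sep_subset _ _) hYne).1
  refine ⟨μ, hμ, fun x hx => ?_, fun χ hχ h x hx => ?_⟩
  · have : x ∈ ⋃ χ ∈ Y, (χ.lower.asIdeal : Set R) := e ▸ hx
    obtain ⟨χ, hχ, hx⟩ := Set.mem_iUnion₂.1 this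
    exact hχ.2 hx
  · have : x ∈ ⋃ χ ∈ Y, (χ.lower.asIdeal : Set R) := Set.mem_iUnion₂.2 ⟨χ, ⟨hχ, h⟩, hx⟩
    rw [← e] at this
    exact this

/-- The pair to test with depends on what lies immediately above `μ`: intervals accumulating at `μ`,
a next interval `ν`, or nothing. Maximality of `μ` excludes the annihilator from containing a higher
lower end. -/
theorem isSat_of_passesTests (hX : IsAdmissible X) {M : Type u} [AddCommGroup M] [Module R M]
    (hM : PassesTests X M) {m : M} {μ : SpecInterval R} (hμ : μ ∈ X)
    (hmax : ∀ χ ∈ X, χ.lower.asIdeal ≤ Ideal.torsionOf R M m → χ.lower ≤ μ.lower) :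
    IsSat μ.upper (Ideal.torsionOf R M m) := by
  intro s hs r hsr
  set I := Ideal.torsionOf R M m with hI
  have hs0 : s ≠ 0 := by
    rintro rfl
    exact hs (zero_mem _)
  have test : ∀ J S, IsTestPair X J S → ∀ a ∈ J, (∃ s ∈ S, s * a ∈ I) →
      ∃ b ∈ J, ∃ c ∈ I, a = b * c := by
    rintro J S h a ha ⟨s, hs, hsa⟩
    obtain ⟨b, hb, c, e, hc⟩ := hM J S h m a ha ⟨s, hs, by
      rw [← mul_smul]
      exact hsa⟩
    exact ⟨b, hb, c, hc, e⟩
  have test' : ∀ J S, IsTestPair X J S → ∀ a ∈ J, (∃ s ∈ S, s * a ∈ I) → a ∈ I := by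
    intro J S h a ha hs
    obtain ⟨b, -, c, hc, rfl⟩ := test J S h a ha hs
    exact I.mul_mem_left b hc
  let Z : Set (SpecInterval R) := {ξ ∈ X | μ.upper < ξ.lower}
  by_cases hZ : Z.Nonempty
  · obtain ⟨ν, hν, e⟩ := (hX.complete Z (Set.sep_subset _ _) hZ).2
    have hνle : ∀ ξ ∈ Z, ν.upper ≤ ξ.upper := fun ξ hξ x hx =>
      Set.mem_iInter₂.1 (e ▸ hx : x ∈ ⋂ χ ∈ Z, (χ.upper.asIdeal : Set R)) ξ hξ
    rcases hX.upper_le_or hν hμ with h | h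
    -- Accumulation: some `ξ` above `μ` has `s ∉ ξ.upper`, and the pair of `ξ` itself factors `s r`
    -- so that `s` can be cancelled.
    · have hsν : s ∉ ⋂ χ ∈ Z, (χ.upper.asIdeal : Set R) := by
        rw [← e]
        exact fun h' => hs (h h')
      simp only [Set.mem_iInter, not_forall] at hsν
      obtain ⟨ξ, hξ, hsξ⟩ := hsν
      have hsξ' : s ∉ ξ.lower.asIdeal := fun h' => hsξ (ξ.lower_le_upper h')
      have hr : r ∈ ξ.lower.asIdeal := by
        by_contra hr
        have hsr' : s * r ∉ ξ.lower.asIdeal := fun h' => (ξ.lower.2.mem_or_mem h').elim hsξ' hr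
        exact absurd (hmax ξ hξ.1 (le_of_notMem_prime hsr hsr'))
          (not_le_of_gt (μ.lower_le_upper.trans_lt hξ.2))
      obtain ⟨b, hb, c, hc, hbc⟩ := test _ _ (hX.isTestPair_interval hξ.1) (s * r)
        (Ideal.mul_mem_left _ s hr) ⟨1, one_mem _, by rwa [one_mul]⟩
      rcases ValuationRing.dvd_total s b with ⟨d, rfl⟩ | ⟨d, rfl⟩
      · have : r = d * c := mul_left_cancel₀ hs0 (by rw [hbc]; ring)
        rw [this]
        exact I.mul_mem_left d hc
      · exact absurd (Ideal.mul_mem_right d _ hb) hsξ'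
    -- The gap between `μ` and the next interval `ν` is a test pair.
    · have hpair : IsTestPair X ν.lower.asIdeal μ.upper.asIdeal.primeCompl := by
        refine ⟨hX.lower_mul_self hν, fun η hη => ?_,
          Or.inr ⟨μ, hμ, μ.lower_le_upper.trans h.le, rfl⟩⟩
        rcases hX.upper_le_or hη hμ with h' | h'
        · exact Or.inr ⟨fun h'' => (h'.trans_lt h).not_ge h'', fun s hs hs' => hs (h' hs')⟩
        · refine Or.inl ((hX.lower_le_or hη hν).resolve_right fun h'' => ?_)
          exact ((hνle η ⟨hη, h'⟩).trans_lt h'').not_ge ν.lower_le_upper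
      by_cases hr : r ∈ ν.lower.asIdeal
      · exact test' _ _ hpair r hr ⟨s, hs, hsr⟩
      · have hle : ν.lower.asIdeal ≤ I := by
          intro a ha
          rcases ValuationRing.dvd_total r a with ⟨d, rfl⟩ | ⟨d, rfl⟩
          · refine test' _ _ hpair _ ha ⟨s, hs, ?_⟩
            rw [← mul_assoc]
            exact I.mul_mem_right d hsr
          · exact absurd (Ideal.mul_mem_right d _ ha) hr
        exact absurd (hmax ν hν hle) (not_le_of_gt (μ.lower_le_upper.trans_lt h))
  · have hpair : IsTestPair X ⊤ μ.upper.asIdeal.primeCompl := by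
      refine ⟨by simp, fun η hη => Or.inr ⟨fun h => η.upper.2.ne_top (top_le_iff.1 h), ?_⟩,
        Or.inr ⟨μ, hμ, le_top, rfl⟩⟩
      intro s hs hs'
      rcases hX.upper_le_or hη hμ with h | h
      · exact hs (h hs')
      · exact hZ ⟨η, hη, h⟩
    exact test' _ _ hpair r Submodule.mem_top ⟨s, hs, hsr⟩

theorem classOfSystem_iff (hX : IsAdmissible X) {M : ModuleCat.{u} R} :
    classOfSystem X M ↔ PassesTests X M := by
  refine ⟨passesTests, fun hM m hm => ?_⟩
  obtain ⟨μ, hμ, hle, hmax⟩ := hX.exists_maximal_lower hM hm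
  refine ⟨μ, hμ, SpecInterval.mem_ideals.2 ⟨?_, hle, hX.isSat_of_passesTests hM hμ hmax⟩⟩
  rwa [Ne, Ideal.torsionOf_eq_top_iff]

end IsAdmissible

end TestPairs

end Cosilting

namespace Cosilting

/-! ### The cosilting module of an admissible system. -/

section Construction

variable {R : Type u} [CommRing R] (X : Set (SpecInterval R))

/-- The index type of all test pairs. -/
abbrev TestPair : Type u := {p : Ideal R × Submonoid R // IsTestPair X p.1 p.2}

/-- The canonical map `J → S⁻¹R` of a test pair. -/
noncomputable def TestPair.map {X : Set (SpecInterval R)} (i : TestPair X) :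
    i.1.1 →ₗ[R] Localization i.1.2 := idealToLoc i.1.1 i.1.2

/-- The product of the duals of the canonical maps of all test pairs. -/
noncomputable def sigmaMap : (∀ i : TestPair X, CharacterModule (Localization i.1.2)) →ₗ[R]
    ∀ i : TestPair X, CharacterModule i.1.1 :=
  LinearMap.pi fun i => CharacterModule.dual i.map ∘ₗ LinearMap.proj i

/-- The cosilting module attached to an admissible system. -/
noncomputable def cosiltingModule : ModuleCat.{u} R := ModuleCat.of R (LinearMap.ker (sigmaMap X))

variable {X}

theorem sigmaMap_lifts_iff {M : Type u} [AddCommGroup M] [Module R M] :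
    (∀ f : M →ₗ[R] ∀ i : TestPair X, CharacterModule i.1.1,
      ∃ g : M →ₗ[R] ∀ i : TestPair X, CharacterModule (Localization i.1.2),
        sigmaMap X ∘ₗ g = f) ↔
      ∀ i : TestPair X, Function.Injective (i.map.lTensor M) := by
  classical
  simp only [← dual_comp_surjective_iff]
  constructor
  · intro h i f
    obtain ⟨g, hg⟩ := h (LinearMap.single R (fun i : TestPair X => CharacterModule i.1.1) i ∘ₗ f)
    refine ⟨LinearMap.proj i ∘ₗ g, ?_⟩
    ext1 m
    refine (congrFun (LinearMap.congr_fun hg m) i).trans ?_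
    exact Pi.single_eq_same _ _
  · intro h f
    choose g hg using fun i => h i (LinearMap.proj i ∘ₗ f)
    refine ⟨LinearMap.pi g, ?_⟩
    ext1 m
    funext i
    exact LinearMap.congr_fun (hg i) m

theorem injective_characterModule {M : Type u} [AddCommGroup M] [Module R M] [Module.Flat R M] :
    Module.Injective R (CharacterModule M) :=
  Module.Flat.iff_characterModule_injective.1 inferInstance

theorem classOfSystem_of_injective {M N : Type u} [AddCommGroup M] [Module R M] [AddCommGroup N]
    [Module R N] (f : M →ₗ[R] N) (hf : Function.Injective f)
    (h : classOfSystem X (ModuleCat.of R N)) : classOfSystem X (ModuleCat.of R M) := by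
  intro m hm
  obtain ⟨χ, hχ, h⟩ := h (f m) ((map_ne_zero_iff f hf).2 hm)
  have e : Ideal.torsionOf R M m = Ideal.torsionOf R N (f m) := by
    ext r
    rw [Ideal.mem_torsionOf_iff, Ideal.mem_torsionOf_iff, ← map_smul, map_eq_zero_iff f hf]
  exact ⟨χ, hχ, e ▸ h⟩

/-- A zero localization is compatible with an interval starting at `0` only if `J = 0`; all other
localizations are at primes of a domain. So every test map is injective. -/
theorem sigmaMap_surjective [IsDomain R]
    (h : ∃ χ ∈ X, χ.lower.asIdeal = ⊥) : Function.Surjective (sigmaMap X) := by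
  have hinj : ∀ i : TestPair X, Function.Injective i.map := by
    rintro ⟨⟨J, S⟩, hJS⟩
    rcases hJS.eq with hS | ⟨χ, hχ, hle, hS⟩
    · obtain ⟨χ, hχ, hbot⟩ := h
      change S = ⊤ at hS
      have hJ : J = ⊥ := by
        rcases hJS.cut χ hχ with h' | ⟨-, h'⟩
        · exact le_bot_iff.1 (hbot ▸ h')
        · exact absurd (zero_mem _) (h' 0 (hS ▸ trivial))
      subst hJ
      exact Function.injective_of_subsingleton (α := (⊥ : Ideal R)) _
    · change S = χ.upper.asIdeal.primeCompl at hS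
      subst hS
      exact (IsLocalization.injective (Localization χ.upper.asIdeal.primeCompl)
        χ.upper.asIdeal.primeCompl_le_nonZeroDivisors).comp (Submodule.injective_subtype J)
  intro y
  choose x hx using fun i => CharacterModule.dual_surjective_of_injective _ (hinj i) (y i)
  exact ⟨x, funext hx⟩

theorem injective_source :
    Module.Injective R (∀ i : TestPair X, CharacterModule (Localization i.1.2)) := by
  have : ∀ i : TestPair X, Module.Injective R (CharacterModule (Localization i.1.2)) := fun i => by
    have := IsLocalization.flat (R := R) (Localization i.1.2) i.1.2
    exact injective_characterModule
  infer_instance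

variable [IsDomain R] [ValuationRing R]

theorem IsAdmissible.homSurjClass_sigmaMap (hX : IsAdmissible X) :
    homSurjClass (Q₀ := ModuleCat.of R (∀ i : TestPair X, CharacterModule (Localization i.1.2)))
      (Q₁ := ModuleCat.of R (∀ i : TestPair X, CharacterModule i.1.1)) (sigmaMap X) =
      classOfSystem X := by
  ext M
  rw [hX.classOfSystem_iff]
  refine (sigmaMap_lifts_iff (X := X) (M := M)).trans ?_
  constructor
  · intro h J S hJS
    exact (lTensor_idealToLoc_injective_iff J S).1 (h ⟨(J, S), hJS⟩)
  · intro h i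
    exact (lTensor_idealToLoc_injective_iff i.1.1 i.1.2).2 (h _ _ i.2)

theorem injective_target : Module.Injective R (∀ i : TestPair X, CharacterModule i.1.1) := by
  have : ∀ i : TestPair X, Module.Injective R (CharacterModule i.1.1) := fun i => by
    have := flat_ideal i.1.1
    exact injective_characterModule
  infer_instance

/-- The annihilator is the intersection over the coordinates and is governed by the interval `ν`
whose upper end is the intersection of the upper ends. -/
theorem IsAdmissible.classOfSystem_pi (hX : IsAdmissible X) {I : Type u} (M : I → Type u)
    [∀ i, AddCommGroup (M i)] [∀ i, Module R (M i)]
    (hM : ∀ i, classOfSystem X (ModuleCat.of R (M i))) :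
    classOfSystem X (ModuleCat.of R (∀ i, M i)) := by
  intro x hx
  change ∀ i, M i at x
  change x ≠ 0 at hx
  change ∃ χ ∈ X, Ideal.torsionOf R (∀ i, M i) x ∈ χ.ideals
  have hmem : ∀ r, r ∈ Ideal.torsionOf R (∀ i, M i) x ↔ ∀ i, r ∈ Ideal.torsionOf R (M i) (x i) := by
    intro r
    simp only [Ideal.mem_torsionOf_iff, funext_iff, Pi.smul_apply, Pi.zero_apply]
  have h : ∀ i : {i // x i ≠ 0}, ∃ χ ∈ X, Ideal.torsionOf R (M i) (x i) ∈ χ.ideals := fun i =>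
    hM i (x i) i.2
  choose χ hχ hI using h
  simp only [SpecInterval.mem_ideals] at hI
  obtain ⟨i₀, hi₀⟩ := Function.ne_iff.1 hx
  obtain ⟨ν, hν, e⟩ := (hX.complete (Set.range χ) (Set.range_subset_iff.2 hχ)
    ⟨_, ⟨i₀, hi₀⟩, rfl⟩).2
  have hνmem : ∀ s, s ∈ ν.upper.asIdeal ↔ ∀ i, s ∈ (χ i).upper.asIdeal := by
    intro s
    have : s ∈ ν.upper.asIdeal ↔ s ∈ ⋂ ξ ∈ Set.range χ, (ξ.upper.asIdeal : Set R) := by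
      rw [← e]
      rfl
    rw [this, Set.biInter_range]
    simp only [Set.mem_iInter, SetLike.mem_coe]
  have hνle : ∀ i, ν.upper ≤ (χ i).upper := fun i s hs => (hνmem s).1 hs i
  refine ⟨ν, hν, SpecInterval.mem_ideals.2 ⟨fun h => (hI ⟨i₀, hi₀⟩).1 ?_, fun r hr => ?_, ?_⟩⟩
  · rw [Ideal.eq_top_iff_one]
    exact (hmem 1).1 (h ▸ Submodule.mem_top) i₀
  · refine (hmem r).2 fun i => ?_
    by_cases hi : x i = 0
    · simp [hi]
    have hle : ν.lower ≤ (χ ⟨i, hi⟩).lower := (hX.lower_le_or (hχ _) hν).resolve_right fun h =>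
      ((hνle _).trans_lt h).not_ge ν.lower_le_upper
    exact (hI ⟨i, hi⟩).2.1 (hle hr)
  · intro s hs z hz
    refine (hmem z).2 fun i => ?_
    by_cases hi : x i = 0
    · simp [hi]
    have hs' : ∃ k, s ∉ (χ k).upper.asIdeal := by
      by_contra! h
      exact hs ((hνmem s).2 h)
    obtain ⟨k, hk⟩ := hs'
    rcases hX.lower_le_or (hχ k) (hχ ⟨i, hi⟩) with h | h
    · have hle : (χ ⟨i, hi⟩).upper ≤ (χ k).upper :=
        (hX.upper_le_or (hχ ⟨i, hi⟩) (hχ k)).resolve_right fun h' =>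
          (h'.trans_le h).not_ge (χ k).lower_le_upper
      exact (hI ⟨i, hi⟩).2.2 s (fun h' => hk (hle h')) z ((hmem _).1 hz i)
    · exact (hI ⟨i, hi⟩).2.1 (h.le ((hI k).2.2.le (hI k).1
        ((hI k).2.2 s hk z ((hmem _).1 hz k))))

/-- These are the characters of `S⁻¹R` vanishing on `J`. Elements outside `χ.upper` act invertibly
on the localization, and multiplication by `χ.lower` sends it into the image of `χ.lower ≤ J`. -/
theorem classOfSystem_ker_dual (i : TestPair X) :
    classOfSystem X (ModuleCat.of R (LinearMap.ker (CharacterModule.dual i.map))) := by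
  obtain ⟨⟨J, S⟩, hJS⟩ := i
  rintro ⟨f, hf⟩ hne
  have hf0 : f ≠ 0 := fun h => hne (Subtype.ext h)
  change ∃ χ ∈ X, Ideal.torsionOf R (LinearMap.ker (CharacterModule.dual _)) ⟨f, hf⟩ ∈ χ.ideals
  rw [IsLimitClosed.torsionOf_coe]
  change ∃ χ ∈ X, Ideal.torsionOf R (CharacterModule (Localization S)) f ∈ χ.ideals
  have hfJ : ∀ a ∈ J, f (algebraMap R (Localization S) a) = 0 := fun a ha =>
    DFunLike.congr_fun (LinearMap.mem_ker.1 hf) (⟨a, ha⟩ : J)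
  have hmem : ∀ r, r ∈ Ideal.torsionOf R (CharacterModule (Localization S)) f ↔
      ∀ x, f (r • x) = 0 := by
    intro r
    rw [Ideal.mem_torsionOf_iff, DFunLike.ext_iff]
    rfl
  rcases hJS.eq with h | ⟨χ, hχ, hle, h⟩
  · change S = ⊤ at h
    subst h
    have : Subsingleton (Localization (⊤ : Submonoid R)) :=
      IsLocalization.subsingleton (M := (⊤ : Submonoid R)) trivial
    refine absurd (DFunLike.ext _ _ fun x => ?_) hf0
    rw [Subsingleton.elim x 0, map_zero]
    rfl
  · change S = χ.upper.asIdeal.primeCompl at h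
    subst h
    refine ⟨χ, hχ, SpecInterval.mem_ideals.2 ⟨?_, fun r hr => (hmem r).2 fun x => ?_, ?_⟩⟩
    · rwa [Ne, Ideal.torsionOf_eq_top_iff]
    · obtain ⟨a, s, rfl⟩ := IsLocalization.exists_mk'_eq χ.upper.asIdeal.primeCompl x
      have hs : (s : R) ∉ χ.lower.asIdeal := fun h => s.2 (χ.lower_le_upper h)
      rcases ValuationRing.dvd_total (s : R) (r * a) with ⟨c, hc⟩ | ⟨c, hc⟩
      · have hcl : c ∈ χ.lower.asIdeal := by
          refine (χ.lower.2.mem_or_mem (x := (s : R)) ?_).resolve_left hs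
          rw [← hc]
          exact Ideal.mul_mem_right a _ hr
        rw [IsLocalization.smul_mk', hc, IsLocalization.mk'_mul_cancel_left]
        exact hfJ c (hle hcl)
      · refine absurd ?_ hs
        rw [hc, mul_assoc]
        exact Ideal.mul_mem_right _ _ hr
    · intro s hs z hz
      refine (hmem z).2 fun x => ?_
      obtain ⟨y, rfl⟩ : ∃ y, s • y = x := by
        obtain ⟨a, t, rfl⟩ := IsLocalization.exists_mk'_eq χ.upper.asIdeal.primeCompl x
        refine ⟨IsLocalization.mk' _ a (t * ⟨s, hs⟩ : χ.upper.asIdeal.primeCompl), ?_⟩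
        rw [IsLocalization.smul_mk', mul_comm t, mul_comm s]
        exact IsLocalization.mk'_cancel (S := Localization χ.upper.asIdeal.primeCompl) a t
          (⟨s, hs⟩ : χ.upper.asIdeal.primeCompl) |> fun h => by rw [← h, mul_comm t]
      have := (hmem _).1 hz y
      rwa [mul_smul, smul_comm] at this

theorem IsAdmissible.classOfSystem_cosiltingModule (hX : IsAdmissible X) :
    classOfSystem X (cosiltingModule X) := by
  refine classOfSystem_of_injective (M := LinearMap.ker (sigmaMap X))
    (N := ∀ i : TestPair X, LinearMap.ker (CharacterModule.dual i.map))
    (LinearMap.pi fun i => LinearMap.codRestrict (LinearMap.ker (CharacterModule.dual i.map))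
      (LinearMap.proj (R := R) (φ := fun i : TestPair X => CharacterModule (Localization i.1.2)) i ∘ₗ
        Submodule.subtype (LinearMap.ker (sigmaMap X)))
      fun x => LinearMap.mem_ker.2 (congrFun (LinearMap.mem_ker.1 x.2) i)) ?_
    (hX.classOfSystem_pi _ fun i => classOfSystem_ker_dual i)
  intro x y hxy
  refine Subtype.ext (funext fun i => ?_)
  exact congrArg Subtype.val (congrFun hxy i)

/-- With `χ = [p, q]`, this says that `m` is nonzero in `M_q / p M_q`. A relation `s m = s a y` with
`a ∈ p` would force `s a y = 0`, wherever the interval of `Ann y` lies, and hence `s ∈ Ann m ≤ q`.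
-/
theorem IsAdmissible.notMem_range (hX : IsAdmissible X) {M : ModuleCat.{u} R}
    (hM : classOfSystem X M) {m : M} {χ : SpecInterval R} (hχ : χ ∈ X)
    (hI : Ideal.torsionOf R M m ∈ χ.ideals) :
    m ⊗ₜ[R] (1 : Localization χ.upper.asIdeal.primeCompl) ∉
      LinearMap.range ((idealToLoc χ.lower.asIdeal χ.upper.asIdeal.primeCompl).lTensor M) := by
  rintro ⟨t, ht⟩
  obtain ⟨y, ⟨a, ha⟩, rfl⟩ := exists_tmul _ t
  rw [LinearMap.lTensor_tmul, idealToLoc_apply, Algebra.algebraMap_eq_smul_one,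
    ← TensorProduct.smul_tmul, eq_comm, ← sub_eq_zero, ← TensorProduct.sub_tmul,
    tmul_loc_eq_zero_iff] at ht
  obtain ⟨s, hs, h⟩ := ht
  change s • (m - a • y) = 0 at h
  obtain ⟨hIt, h1, h2⟩ := SpecInterval.mem_ideals.1 hI
  have hs' : s ∉ Ideal.torsionOf R M m := fun h => hs (h2.le hIt h)
  have hsm : s • m = (s * a) • y := by
    rw [mul_smul, ← sub_eq_zero, ← smul_sub, h]
  have hy : y ≠ 0 := by
    rintro rfl
    exact hs' (by rw [Ideal.mem_torsionOf_iff, hsm, smul_zero])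
  obtain ⟨ξ, hξ, hJ⟩ := hM y hy
  obtain ⟨hJt, h3, h4⟩ := SpecInterval.mem_ideals.1 hJ
  have hkill : ∀ t ∈ χ.lower.asIdeal, t * (s * a) ∈ Ideal.torsionOf R M y := by
    intro t ht
    rw [Ideal.mem_torsionOf_iff, mul_smul, ← hsm, smul_comm, (Ideal.mem_torsionOf_iff m t).1 (h1 ht),
      smul_zero]
  have hsa : s * a ∉ Ideal.torsionOf R M y := fun h' =>
    hs' (by rw [Ideal.mem_torsionOf_iff, hsm]; exact h')
  rcases hX.lower_le_or hξ hχ with h' | h'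
  · exact hsa (Ideal.mul_mem_left _ s (h3 (h' ha)))
  · obtain ⟨t, ht, htξ⟩ := SetLike.not_le_iff_exists.1 fun h'' : χ.lower.asIdeal ≤ _ => h'.not_ge h''
    exact hsa (h4 t htξ _ (hkill t ht))

theorem IsAdmissible.exists_hom (hX : IsAdmissible X) {M : ModuleCat.{u} R}
    (hM : classOfSystem X M) {m : M} (hm : m ≠ 0) :
    ∃ f : M →ₗ[R] LinearMap.ker (sigmaMap X), f m ≠ 0 := by
  classical
  obtain ⟨χ, hχ, hI⟩ := hM m hm
  let i : TestPair X := ⟨(χ.lower.asIdeal, χ.upper.asIdeal.primeCompl), hX.isTestPair_interval hχ⟩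
  have hnot : m ⊗ₜ[R] (1 : Localization i.1.2) ∉ LinearMap.range (i.map.lTensor M) :=
    hX.notMem_range hM hχ hI
  -- A character of `M_q / p M_q` that detects `m` is, by adjunction, a map from `M` into the factor
  -- of `ker σ` belonging to `χ`.
  obtain ⟨c, hc⟩ := CharacterModule.exists_character_apply_ne_zero_of_ne_zero
    (mt (Submodule.Quotient.mk_eq_zero _).1 hnot)
  let g : M →ₗ[R] CharacterModule (Localization i.1.2) :=
    CharacterModule.curry (CharacterModule.dual (Submodule.mkQ _) c)
  have hg : ∀ x l, g x l = c (Submodule.Quotient.mk (x ⊗ₜ l)) := fun x l => rfl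
  let f : M →ₗ[R] ∀ i : TestPair X, CharacterModule (Localization i.1.2) :=
    LinearMap.single R (fun i : TestPair X => CharacterModule (Localization i.1.2)) i ∘ₗ g
  have hf : ∀ x, f x ∈ LinearMap.ker (sigmaMap X) := by
    intro x
    rw [LinearMap.mem_ker]
    funext j
    change CharacterModule.dual j.map (f x j) = 0
    by_cases hj : j = i
    · subst hj
      have : f x i = g x := Pi.single_eq_same _ _
      rw [this]
      ext a
      change g x (i.map a) = 0
      rw [hg, (Submodule.Quotient.mk_eq_zero _).2
        (LinearMap.mem_range.2 ⟨x ⊗ₜ a, LinearMap.lTensor_tmul _ _ _ _⟩), map_zero]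
    · have : f x j = 0 := Pi.single_eq_of_ne hj _
      rw [this, map_zero]
  refine ⟨f.codRestrict _ hf, fun h => hc ?_⟩
  have h' : f m i = 0 := congrFun (congrArg Subtype.val h) i
  have : f m i = g m := Pi.single_eq_same _ _
  rw [← hg, ← this, h']
  rfl

theorem IsAdmissible.cogen_cosiltingModule (hX : IsAdmissible X) :
    cogen (cosiltingModule X) = classOfSystem X := by
  ext M
  constructor
  · rintro ⟨I, f, hf⟩
    exact classOfSystem_of_injective f hf
      (hX.classOfSystem_pi _ fun _ => hX.classOfSystem_cosiltingModule)
  · intro hM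
    choose f hf using fun m : {m : M // m ≠ 0} => hX.exists_hom hM m.2
    refine ⟨{m : M // m ≠ 0}, LinearMap.pi f, (injective_iff_map_eq_zero _).2 fun m hm => ?_⟩
    by_contra hm0
    exact hf ⟨m, hm0⟩ (congrFun hm ⟨m, hm0⟩)

theorem IsAdmissible.isCosiltingModule (hX : IsAdmissible X) :
    IsCosiltingModule (cosiltingModule X) :=
  ⟨ModuleCat.of R _, ModuleCat.of R _, (LinearMap.ker (sigmaMap X)).subtype, sigmaMap X,
    injective_source, injective_target, Submodule.injective_subtype _,
    LinearMap.exact_subtype_ker_map _, hX.homSurjClass_sigmaMap.trans hX.cogen_cosiltingModule.symm⟩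

theorem IsAdmissible.isCosiltingClass (hX : IsAdmissible X) :
    IsCosiltingClass (classOfSystem X) :=
  ⟨_, hX.isCosiltingModule, hX.cogen_cosiltingModule.symm⟩

end Construction

end Cosilting

namespace Cosilting

/-! ### Limit closed classes and definable torsion-free classes. -/

section Definable

variable {R : Type u} [CommRing R] {C : ObjectProperty (ModuleCat.{u} R)}

theorem IsDefinableClass.isLimitClosed (hC : IsDefinableClass C) (hC' : IsTorsionFreeClass C) :
    IsLimitClosed C := by
  classical
  obtain ⟨𝒯, -, hF⟩ := hC'
  have hinj : ∀ {M N : Type u} [AddCommGroup M] [Module R M] [AddCommGroup N] [Module R N]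
      (f : M →ₗ[R] N), Function.Injective f → C (ModuleCat.of R N) → C (ModuleCat.of R M) := by
    intro M N _ _ _ _ f hf hN
    refine (hF (ModuleCat.of R M)).2 fun L hL g => LinearMap.ext fun x => hf ?_
    have := DFunLike.congr_fun ((hF (ModuleCat.of R N)).1 hN L hL (f.comp g)) x
    rw [LinearMap.zero_apply, map_zero]
    exact this
  refine ⟨hinj, ?_, ?_, ?_⟩
  · intro I M _ _ hM
    refine (hF (ModuleCat.of R (∀ i, M i))).2 fun L hL g => LinearMap.ext fun x => funext fun i => ?_
    exact DFunLike.congr_fun ((hF (ModuleCat.of R (M i))).1 (hM i) L hL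
      ((LinearMap.proj (R := R) (φ := M) i).comp g)) x
  · intro M _ _ N hN hQ
    refine (hF (ModuleCat.of R M)).2 fun L hL g => ?_
    have h1 : ∀ x, g x ∈ N := fun x => (Submodule.Quotient.mk_eq_zero N).1
      (DFunLike.congr_fun ((hF (ModuleCat.of R (M ⧸ N))).1 hQ L hL (N.mkQ.comp g)) x)
    have h2 := (hF (ModuleCat.of R N)).1 hN L hL (LinearMap.codRestrict N g h1)
    exact LinearMap.ext fun x => congrArg Subtype.val (DFunLike.congr_fun h2 x)
  · intro M _ _ ι _ _ _ _ N hN hQ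
    let G : ι → Type u := fun j => M ⧸ N j
    let f : ∀ i j, i ≤ j → G i →ₗ[R] G j := fun i j h => Submodule.factor (hN h)
    have : DirectedSystem G fun i j h => f i j h :=
      { map_self := fun i x => by
          obtain ⟨m, rfl⟩ := Submodule.Quotient.mk_surjective _ x
          rfl
        map_map := fun i j k hij hjk x => by
          obtain ⟨m, rfl⟩ := Submodule.Quotient.mk_surjective _ x
          rfl }
    have := hC.directLimits ι
    have hlim : C (ModuleCat.of R (Module.DirectLimit G f)) :=
      C.prop_of_isColimit (ModuleCat.directLimitIsColimit G f) hQ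
    obtain ⟨j₀⟩ := ‹Nonempty ι›
    -- The map `g` does not depend on the starting index, and its kernel is the union of the `N j`.
    let g : M →ₗ[R] Module.DirectLimit G f := (Module.DirectLimit.of R ι G f j₀).comp (N j₀).mkQ
    have hg : ∀ j m, g m = Module.DirectLimit.of R ι G f j ((N j).mkQ m) := by
      intro j m
      rcases le_total j₀ j with h | h
      · exact (Module.DirectLimit.of_f (G := G) (f := f) (hij := h) (x := (N j₀).mkQ m)).symm
      · exact Module.DirectLimit.of_f (G := G) (f := f) (hij := h) (x := (N j).mkQ m)
    have hker : (⨆ j, N j) = LinearMap.ker g := by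
      refine le_antisymm (iSup_le fun j m hm => ?_) fun m hm => ?_
      · rw [LinearMap.mem_ker, hg j, Submodule.mkQ_apply, (Submodule.Quotient.mk_eq_zero _).2 hm,
          map_zero]
      · obtain ⟨j, hj, h⟩ := Module.DirectLimit.of.zero_exact (LinearMap.mem_ker.1 hm)
        exact Submodule.mem_iSup_of_mem j ((Submodule.Quotient.mk_eq_zero _).1 h)
    exact hinj ((⨆ j, N j).liftQ g hker.le)
      (LinearMap.ker_eq_bot.1 (Submodule.ker_liftQ_eq_bot' _ _ hker)) hlim

/-- The class of modules without nonzero homomorphisms to modules in `C`. -/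
def leftHomOrthogonal (C : ObjectProperty (ModuleCat.{u} R)) :
    ObjectProperty (ModuleCat.{u} R) := fun M =>
  ∀ N, C N → ∀ f : M →ₗ[R] N, f = 0

namespace IsLimitClosed

/-- The least submodule `sInf S` with quotient in `C` is torsion: the kernel of a map from it to a
module in `C` again has quotient in `C`, by extension closure, so is everything. -/
theorem isTorsionFreeClass (hC : IsLimitClosed C) : IsTorsionFreeClass C := by
  refine ⟨leftHomOrthogonal C, fun M => Iff.rfl, fun N => ⟨fun hN M hM f => hM N hN f, fun h => ?_⟩⟩
  let S : Set (Submodule R N) := {L | C (ModuleCat.of R (N ⧸ L))}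
  have hK : C (ModuleCat.of R (N ⧸ sInf S)) := by
    refine hC.of_injective (N := ∀ L : S, N ⧸ L.1) ((sInf S).liftQ
      (LinearMap.pi fun L : S => L.1.mkQ) ?_) (LinearMap.ker_eq_bot.1
        (Submodule.ker_liftQ_eq_bot' _ _ ?_)) (hC.pi _ fun L => L.2)
    · intro x hx
      exact LinearMap.mem_ker.2 (funext fun L =>
        (Submodule.Quotient.mk_eq_zero _).2 (Submodule.mem_sInf.1 hx L.1 L.2))
    · refine le_antisymm (fun x hx => LinearMap.mem_ker.2 (funext fun L =>
        (Submodule.Quotient.mk_eq_zero _).2 (Submodule.mem_sInf.1 hx L.1 L.2))) fun x hx => ?_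
      exact Submodule.mem_sInf.2 fun L hL =>
        (Submodule.Quotient.mk_eq_zero _).1 (congrFun (LinearMap.mem_ker.1 hx) ⟨L, hL⟩)
  have hT : leftHomOrthogonal C (ModuleCat.of R (sInf S : Submodule R N)) := by
    intro D hD f
    let f' : (sInf S : Submodule R N) →ₗ[R] D := f
    let K : Submodule R N := (LinearMap.ker f').map (sInf S).subtype
    have hle : K ≤ sInf S := Submodule.map_subtype_le _ _
    have hmem : K ∈ S := by
      refine hC.extension ((sInf S).map K.mkQ) ?_ ?_
      · let g : (sInf S : Submodule R N) →ₗ[R] N ⧸ K := K.mkQ.comp (sInf S).subtype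
        have hg : LinearMap.ker g = LinearMap.ker f' := by
          rw [LinearMap.ker_comp, Submodule.ker_mkQ]
          exact Submodule.comap_map_eq_of_injective (Submodule.injective_subtype _) _
        have hr : LinearMap.range g = (sInf S).map K.mkQ := by
          rw [LinearMap.range_comp, Submodule.range_subtype]
        rw [← hr]
        exact hC.of_injective g.quotKerEquivRange.symm.toLinearMap
          g.quotKerEquivRange.symm.injective (hC.quotient f' hg hD)
      · exact hC.of_injective (Submodule.quotientQuotientEquivQuotient K _ hle).toLinearMap
          (Submodule.quotientQuotientEquivQuotient K _ hle).injective hK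
    have hKS : sInf S ≤ K := sInf_le hmem
    refine LinearMap.ext fun x => ?_
    obtain ⟨y, hy, hyx⟩ := hKS x.2
    have : y = x := Subtype.ext hyx
    rw [← this]
    exact hy
  have h0 := h _ hT (sInf S).subtype
  refine hC.of_injective (sInf S).mkQ (LinearMap.ker_eq_bot.1 ?_) hK
  rw [Submodule.ker_mkQ, ← Submodule.range_subtype (sInf S), h0, LinearMap.range_zero]

variable [IsDomain R] [ValuationRing R]

/-- The annihilator of an element of a directed colimit is the union of the annihilators of its
images at later stages. -/
theorem colimit_mem (hC : IsLimitClosed C) {J : Type u} [PartialOrder J] [IsDirectedOrder J]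
    [Nonempty J] {M : ModuleCat.{u} R} (h : C.ColimitOfShape J M) : C M := by
  refine hC.mem_iff.2 fun m => ?_
  obtain ⟨j, y, rfl⟩ := Limits.Concrete.isColimit_exists_rep h.diag h.isColimit m
  let S : Set (Ideal R) := Set.range fun k : {k : J // j ≤ k} =>
    Ideal.torsionOf R (h.diag.obj k.1) (h.diag.map (homOfLE k.2) y)
  have htor : ∀ k (hk : j ≤ k) r, r ∈ Ideal.torsionOf R (h.diag.obj k) (h.diag.map (homOfLE hk) y) →
      r ∈ sSup S := fun k hk r hr => 
    Ideal.mem_sSup_of_mem (Set.mem_range_self (⟨k, hk⟩ : {k : J // j ≤ k})) hr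
  have hS : S ⊆ cyclicIdeals C := by
    rintro _ ⟨k, rfl⟩
    exact hC.torsionOf_mem (h.prop_diag_obj k.1) _
  have hne : S.Nonempty := ⟨_, ⟨⟨j, le_rfl⟩, rfl⟩⟩
  suffices hs : Ideal.torsionOf R M (h.ι.app j y) = sSup S by
    have := hC.isIdealFamily.sSup_mem hS hne
    rw [← hs] at this
    exact this
  refine le_antisymm (fun r hr => ?_) (sSup_le ?_)
  · have hr' : h.ι.app j (r • y) = h.ι.app j 0 := by
      rw [map_smul, map_zero]
      exact hr
    obtain ⟨k, f, g, hk⟩ := Limits.Concrete.isColimit_exists_of_rep_eq.{u} h.diag h.isColimit _ _ hr'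
    refine htor k (leOfHom f) r ?_
    rw [map_smul, map_zero] at hk
    exact hk
  · rintro _ ⟨k, rfl⟩ r hr
    have hr' : r • h.diag.map (homOfLE k.2) y = 0 := hr
    change r • h.ι.app j y = 0
    rw [← Limits.Concrete.isColimit_rep_eq_of_exists (D := h.cocone) h.diag
      (h.diag.map (homOfLE k.2) y) y ⟨k.1, 𝟙 _, homOfLE k.2, by simp⟩]
    change r • h.ι.app k.1 _ = 0
    rw [← map_smul, hr', map_zero]

theorem isDefinableClass (hC : IsLimitClosed C) : IsDefinableClass C where
  products I := ⟨by
    rintro M ⟨h⟩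
    refine hC.of_injective (M := M) (N := ∀ i : I, h.diag.obj ⟨i⟩)
      (LinearMap.pi fun i => (h.π.app ⟨i⟩).hom) (fun x y hxy => ?_)
      (hC.pi _ fun i => h.prop_diag_obj ⟨i⟩)
    exact Limits.Concrete.isLimit_ext h.diag h.isLimit x y fun i => congrFun hxy i.as⟩
  pureSubmodules M N hM _ := hC.of_injective N.subtype (Submodule.injective_subtype N) hM
  directLimits J _ _ _ := ⟨fun _ ⟨h⟩ => hC.colimit_mem h⟩

end IsLimitClosed

end Definable

end Cosilting

namespace Cosilting

/-! ### The 1-cotilting case. -/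

section Cotilting

variable {R : Type u} [CommRing R]

theorem shortExact_of_linearMap {T Q₀ Q₁ : ModuleCat.{u} R} {i : T →ₗ[R] Q₀} {σ : Q₀ →ₗ[R] Q₁}
    (hi : Function.Injective i) (hex : Function.Exact i σ) (hσ : Function.Surjective σ) :
    (ShortComplex.mk (ModuleCat.ofHom i : T ⟶ Q₀) (ModuleCat.ofHom σ : Q₀ ⟶ Q₁)
      (ModuleCat.hom_ext hex.linearMap_comp_eq_zero)).ShortExact :=
  ModuleCat.shortComplex_shortExact _ hex hi hσ

/-- In the long exact sequence of `0 → T → Q₀ → Q₁ → 0` the term `Ext¹(M, Q₀)` vanishes, so `Ext¹(M,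
T)` is the cokernel of `Hom(M, σ)`. -/
theorem leftExtOrthogonal_eq_homSurjClass {T Q₀ Q₁ : ModuleCat.{u} R} {i : T →ₗ[R] Q₀}
    {σ : Q₀ →ₗ[R] Q₁} (hQ₀ : Module.Injective R Q₀) (hi : Function.Injective i)
    (hex : Function.Exact i σ) (hσ : Function.Surjective σ) :
    leftExtOrthogonal T = homSurjClass σ := by
  have hS := shortExact_of_linearMap hi hex hσ
  have : Injective Q₀ := (Module.injective_iff_injective_object R Q₀).1 hQ₀
  ext M
  constructor
  · intro hM g
    have : Subsingleton (Abelian.Ext.{u} M T 1) := hM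
    obtain ⟨x, hx⟩ := Abelian.Ext.covariant_sequence_exact₃ M hS
      (Abelian.Ext.mk₀ (ModuleCat.ofHom g : M ⟶ Q₁)) (zero_add 1) (Subsingleton.elim (α := Abelian.Ext.{u} M T 1) _ _)
    obtain ⟨f, rfl⟩ := (Abelian.Ext.mk₀_bijective M Q₀).2 x
    refine ⟨f.hom, ?_⟩
    rw [Abelian.Ext.mk₀_comp_mk₀] at hx
    exact congrArg ModuleCat.Hom.hom ((Abelian.Ext.mk₀_bijective M Q₁).1 hx)
  · intro hM
    refine subsingleton_of_forall_eq 0 fun x => ?_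
    obtain ⟨y, rfl⟩ := Abelian.Ext.covariant_sequence_exact₁ M hS x
      (Abelian.Ext.eq_zero_of_hasInjectiveDimensionLT (X := Q₀) _ 1 le_rfl) (zero_add 1)
    obtain ⟨g, rfl⟩ := (Abelian.Ext.mk₀_bijective M Q₁).2 y
    obtain ⟨f, hf⟩ := hM g.hom
    have : g = (ModuleCat.ofHom f : M ⟶ Q₀) ≫ ModuleCat.ofHom σ := ModuleCat.hom_ext hf.symm
    rw [this, ← Abelian.Ext.mk₀_comp_mk₀, Abelian.Ext.comp_assoc_of_second_deg_zero]
    rw [hS.comp_extClass, Abelian.Ext.comp_zero]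

theorem hasInjectiveDimensionLE_one_iff {T Q₀ Q₁ : ModuleCat.{u} R} {i : T →ₗ[R] Q₀}
    {σ : Q₀ →ₗ[R] Q₁} (hQ₀ : Module.Injective R Q₀) (hi : Function.Injective i)
    (hex : Function.Exact i σ) (hσ : Function.Surjective σ) :
    HasInjectiveDimensionLE T 1 ↔ Module.Injective R Q₁ := by
  have hS := shortExact_of_linearMap hi hex hσ
  have : Injective Q₀ := (Module.injective_iff_injective_object R Q₀).1 hQ₀
  refine (hS.hasInjectiveDimensionLT_X₃_iff 0 this).symm.trans
    (injective_iff_hasInjectiveDimensionLT_one.symm.trans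
      (Module.injective_iff_injective_object R Q₁).symm)

theorem IsOneCotiltingModule.exists_surjective {T : ModuleCat.{u} R} (hT : IsOneCotiltingModule T) :
    ∃ (Q₀ Q₁ : ModuleCat.{u} R) (i : T →ₗ[R] Q₀) (σ : Q₀ →ₗ[R] Q₁),
      Module.Injective R Q₀ ∧ Module.Injective R Q₁ ∧ Function.Injective i ∧
      Function.Exact i σ ∧ Function.Surjective σ ∧ homSurjClass σ = cogen T := by
  let Q₀ : ModuleCat.{u} R := Injective.under T
  let i : T →ₗ[R] Q₀ := (Injective.ι T).hom
  have hQ₀ : Module.Injective R Q₀ :=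
    (Module.injective_iff_injective_object R Q₀).2 (Injective.injective_under T)
  have hi : Function.Injective i := (ModuleCat.mono_iff_injective _).1 inferInstance
  let Q₁ : ModuleCat.{u} R := ModuleCat.of R (Q₀ ⧸ LinearMap.range i)
  let σ : Q₀ →ₗ[R] Q₁ := (LinearMap.range i).mkQ
  have hex : Function.Exact i σ := LinearMap.exact_map_mkQ_range i
  have hσ : Function.Surjective σ := Submodule.mkQ_surjective _
  exact ⟨Q₀, Q₁, i, σ, hQ₀, (hasInjectiveDimensionLE_one_iff hQ₀ hi hex hσ).1 hT.1, hi, hex, hσ,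
    (leftExtOrthogonal_eq_homSurjClass hQ₀ hi hex hσ).symm.trans hT.2⟩

variable {C : ObjectProperty (ModuleCat.{u} R)}

theorem IsOneCotiltingClass.isCosiltingClass (hC : IsOneCotiltingClass C) :
    IsCosiltingClass C := by
  obtain ⟨T, hT, rfl⟩ := hC
  obtain ⟨Q₀, Q₁, i, σ, h₀, h₁, hi, hex, -, h⟩ := hT.exists_surjective
  exact ⟨T, ⟨Q₀, Q₁, i, σ, h₀, h₁, hi, hex, h⟩, rfl⟩

/-- Projectivity of `R` lifts every map along the surjective `σ`. -/
theorem IsOneCotiltingClass.self_mem (hC : IsOneCotiltingClass C) : C (ModuleCat.of R R) := by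
  obtain ⟨T, hT, rfl⟩ := hC
  obtain ⟨Q₀, Q₁, i, σ, -, -, -, -, hσ, h⟩ := hT.exists_surjective
  rw [← h]
  exact fun g => Module.projective_lifting_property σ (g : R →ₗ[R] Q₁) hσ

theorem exists_lower_eq_bot [Nontrivial R] {X : Set (SpecInterval R)}
    (h : classOfSystem X (ModuleCat.of R R)) : ∃ χ ∈ X, χ.lower.asIdeal = ⊥ := by
  obtain ⟨χ, hχ, hle, -⟩ := h (1 : R) (one_ne_zero (α := R))
  refine ⟨χ, hχ, eq_bot_iff.2 fun r hr => ?_⟩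
  have h1 : r • (1 : R) = 0 := hle hr
  rwa [smul_eq_mul, mul_one] at h1

variable [IsDomain R] [ValuationRing R]

theorem IsAdmissible.isOneCotiltingClass {X : Set (SpecInterval R)} (hX : IsAdmissible X)
    (h : ∃ χ ∈ X, χ.lower.asIdeal = ⊥) : IsOneCotiltingClass (classOfSystem X) := by
  have hex : Function.Exact (LinearMap.ker (sigmaMap X)).subtype (sigmaMap X) :=
    LinearMap.exact_subtype_ker_map _
  have hi := Submodule.injective_subtype (LinearMap.ker (sigmaMap X))
  have hσ := sigmaMap_surjective h
  refine ⟨cosiltingModule X, ⟨?_, ?_⟩, hX.cogen_cosiltingModule.symm⟩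
  · exact (hasInjectiveDimensionLE_one_iff (T := cosiltingModule X) (Q₀ := ModuleCat.of R _)
      (Q₁ := ModuleCat.of R _) injective_source hi hex hσ).2 injective_target
  · exact (leftExtOrthogonal_eq_homSurjClass (T := cosiltingModule X) (Q₀ := ModuleCat.of R _)
      (Q₁ := ModuleCat.of R _) injective_source hi hex hσ).trans
      (hX.homSurjClass_sigmaMap.trans hX.cogen_cosiltingModule.symm)

end Cotilting

end Cosilting

namespace Cosilting

/-! ### The correspondence. -/

section Correspondence

variable {R : Type u} [CommRing R] {C : ObjectProperty (ModuleCat.{u} R)}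

theorem IsCosiltingClass.isLimitClosed (hC : IsCosiltingClass C) : IsLimitClosed C := by
  obtain ⟨T, hT, rfl⟩ := hC
  exact hT.isLimitClosed

theorem isCosiltingClass_iff_isLimitClosed [IsDomain R] [ValuationRing R] :
    IsCosiltingClass C ↔ IsLimitClosed C := by
  refine ⟨IsCosiltingClass.isLimitClosed, fun h => ?_⟩
  rw [← h.classOfSystem_systemOfClass]
  exact h.isAdmissible_systemOfClass.isCosiltingClass

end Correspondence

end Cosilting

theorem theoremT01 (R : Type u) [CommRing R] [IsDomain R] [ValuationRing R] :
    (∀ C : ObjectProperty (ModuleCat.{u} R),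
      Cosilting.IsCosiltingClass C ↔
        Cosilting.IsDefinableClass C ∧ Cosilting.IsTorsionFreeClass C) ∧
    Set.MapsTo (Cosilting.classOfSystem (R := R))
      {X | Cosilting.IsAdmissible X} {C | Cosilting.IsCosiltingClass C} ∧
    Set.MapsTo (Cosilting.systemOfClass (R := R))
      {C | Cosilting.IsCosiltingClass C} {X | Cosilting.IsAdmissible X} ∧
    Set.InvOn (Cosilting.systemOfClass (R := R)) (Cosilting.classOfSystem (R := R))
      {X | Cosilting.IsAdmissible X} {C | Cosilting.IsCosiltingClass C} ∧
    Set.BijOn (Cosilting.classOfSystem (R := R))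
      {X | Cosilting.IsAdmissible X ∧ ∃ χ ∈ X, χ.lower.asIdeal = ⊥}
      {C | Cosilting.IsOneCotiltingClass C} := by
  have hleft : Set.LeftInvOn (Cosilting.systemOfClass (R := R)) (Cosilting.classOfSystem (R := R))
      {X | Cosilting.IsAdmissible X} := fun X hX =>
    Cosilting.IsAdmissible.systemOfClass_classOfSystem hX
      (Cosilting.IsAdmissible.isCosiltingClass hX).isLimitClosed
  refine ⟨fun C => ⟨fun h => ⟨h.isLimitClosed.isDefinableClass, h.isLimitClosed.isTorsionFreeClass⟩,
      fun h => Cosilting.isCosiltingClass_iff_isLimitClosed.2 (h.1.isLimitClosed h.2)⟩,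
    fun X hX => Cosilting.IsAdmissible.isCosiltingClass hX,
    fun C hC => (Cosilting.IsCosiltingClass.isLimitClosed hC).isAdmissible_systemOfClass,
    ⟨hleft, fun C hC => (Cosilting.IsCosiltingClass.isLimitClosed hC).classOfSystem_systemOfClass⟩,
    fun X hX => hX.1.isOneCotiltingClass hX.2,
    hleft.injOn.mono fun X hX => hX.1, fun C hC => ?_⟩
  have hC' := (Cosilting.IsOneCotiltingClass.isCosiltingClass hC).isLimitClosed
  have hCX := hC'.classOfSystem_systemOfClass
  refine ⟨Cosilting.systemOfClass C, ⟨hC'.isAdmissible_systemOfClass,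
    Cosilting.exists_lower_eq_bot ?_⟩, hCX⟩
  rw [hCX]
  exact Cosilting.IsOneCotiltingClass.self_mem hC
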